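/- Let $\mathcal G$ be a connected metric graph with finitely many vertices and edges (loops and multiple edges allowed). Each edge $e$ is identified with an interval $I_e=[0,\ell_e]$, $\ell_e\in(0,\infty]$; the edges of infinite length (half-lines) are those ending at a vertex at infinity, vertices at infinity have degree one and are not joined to each other, and there is at least one of them, so that $\mathcal G$ is noncompact. Let $H^1(\mathcal G)$ be the set of continuous functions $u=(u_e)_e:\mathcal G\to\mathbb C$ with $u_e\in H^1(I_e)$ for every edge $e$. For $\mu\ge 0$ put $$E(u,\mathcal G)=\tfrac12\|u'\|_{L^2(\mathcal G)}^2-\tfrac16\|u\|_{L^6(\mathcal G)}^6,\qquad \mathcal E_{\mathcal G}(\mu)=\inf\{E(u,\mathcal G): u\in H^1(\mathcal G),\ \|u\|_{L^2(\mathcal G)}^2=\mu\},$$ and say that $\mathcal E_{\mathcal G}(\mu)$ is attained if the infimum is a minimum. Let $K_{\mathcal G}$ be the smallest constant $C\ge 0$ such that $\|u\|_6^6\le C\,\|u\|_2^4\,\|u'\|_2^2$ for all $u\in H^1(\mathcal G)$, and let $\mu_{\mathcal G}=\sqrt{3/K_{\mathcal G}}$ be the critical mass of $\mathcal G$; in particular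 $\mu_{\mathbb R^+}$ and $\mu_{\mathbb R}$ are the critical masses of the half-line and of the line. **Theorem 7.1 (Case 1).** One has $0<\mu_{\mathbb R^+}<\mu_{\mathbb R}$. If $\mathcal G$ has at least one terminal point, that is, a vertex of degree one that is not at infinity, then 1. $\mu_{\mathcal G}=\mu_{\mathbb R^+}$; 2. $\mathcal E_{\mathcal G}(\mu)=-\infty$ for every $\mu\in(\mu_{\mathbb R^+},\mu_{\mathbb R}]$; 3. $\mathcal E_{\mathcal G}(\mu_{\mathbb R^+})=0$, and this level is attained if and only if $\mathcal G$ is (isometric to) the half-line $[0,\infty)$. -/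

import Mathlib

open MeasureTheory

/-- A noncompact metric graph with vertices `V` and edges `E` (loops and multiple edges are
allowed).  Some vertices, at least one, lie at infinity.  An edge `e` has a length in `(0, ∞]` and
is identified with the interval `[0, len e]`, the point `0` being the vertex `src e` and the
point `len e` the vertex `tgt e`.  The edges ending at a vertex at infinity are the half-lines:
they are exactly the edges of infinite length and are parametrized from their finite vertex
outwards, so that vertices at infinity are not joined to each other.  A vertex at infinity has
degree one. -/
structure MetricGraph (V E : Type*) where
  src : E → V
  tgt : E → V
  len : E → ENNReal
  infinity : Set V
  len_pos : ∀ e, 0 < len e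
  src_notMem_infinity : ∀ e, src e ∉ infinity
  tgt_mem_infinity_iff : ∀ e, tgt e ∈ infinity ↔ len e = ⊤
  existsUnique_edge_of_mem_infinity : ∀ v ∈ infinity, ∃! e, tgt e = v
  infinity_nonempty : infinity.Nonempty

namespace MetricGraph

variable {V E : Type*} (G : MetricGraph V E)

/-- The number of edge ends at `v` (a loop counts twice). -/
noncomputable def degree (v : V) : ℕ :=
  {e | G.src e = v}.ncard + {e | G.tgt e = v}.ncard

/-- A terminal point is a vertex of degree one that is not at infinity. -/
def IsTerminal (v : V) : Prop :=
  v ∉ G.infinity ∧ G.degree v = 1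

/-- Any two vertices are joined by a chain of edges. -/
def Connected : Prop :=
  (SimpleGraph.fromRel fun v w : V => ∃ e, G.src e = v ∧ G.tgt e = w).Connected

/-- The interval `[0, len e]`, which is `[0, ∞)` if `len e = ∞`. -/
def interval (e : E) : Set ℝ :=
  {x | 0 ≤ x ∧ ENNReal.ofReal x ≤ G.len e}

/-- The point with coordinate `x` on the edge `e` is the (finite) vertex `v`. -/
def IsAt (v : V) (e : E) (x : ℝ) : Prop :=
  (x = 0 ∧ G.src e = v) ∨ (G.len e ≠ ⊤ ∧ x = (G.len e).toReal ∧ G.tgt e = v)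

/-- The pairs `(e, x)` and `(e', x')` represent the same point of the metric graph. -/
def SamePoint (e : E) (x : ℝ) (e' : E) (x' : ℝ) : Prop :=
  (e = e' ∧ x = x') ∨ ∃ v, G.IsAt v e x ∧ G.IsAt v e' x'

/-- The metric graph is a half-line: some map `p` from it to `[0, ∞)` is well defined on points,
bijective, and isometric on every edge.  (Vertices of degree two are thereby irrelevant.) -/
def IsHalfline : Prop :=
  ∃ p : E → ℝ → ℝ,
    (∀ e, ∀ x ∈ G.interval e, ∀ y ∈ G.interval e, |p e x - p e y| = |x - y|) ∧
    (∀ e e', ∀ x ∈ G.interval e, ∀ x' ∈ G.interval e',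
      p e x = p e' x' ↔ G.SamePoint e x e' x') ∧
    (∀ y, 0 ≤ y ↔ ∃ e, ∃ x ∈ G.interval e, p e x = y)

/-- The functions in `H¹(𝒢)`.  On every edge, `val e` is an absolutely continuous function in
`L²` with derivative `der e` in `L²` (in one dimension these are the elements of `H¹` of an
interval, in their continuous representatives; `der e` is determined by `val e` almost
everywhere), and the value at a vertex does not depend on the edge by which it is reached. -/
structure H1 where
  val : E → ℝ → ℂ
  der : E → ℝ → ℂ
  memLp_val : ∀ e, MemLp (val e) 2 (volume.restrict (G.interval e))
  memLp_der : ∀ e, MemLp (der e) 2 (volume.restrict (G.interval e))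
  val_sub_val : ∀ e, ∀ x ∈ G.interval e, ∀ y ∈ G.interval e,
    val e y - val e x = ∫ t in x..y, der e t
  continuous_vertex : ∀ v e x e' x', G.IsAt v e x → G.IsAt v e' x' → val e x = val e' x'

/-- `∫_𝒢 f`, the sum of the integrals over the edges. -/
noncomputable def integral [Fintype E] (f : E → ℝ → ℝ) : ℝ :=
  ∑ e, ∫ x in G.interval e, f e x

variable {G}

/-- The mass `‖u‖₂²`. -/
noncomputable def H1.mass [Fintype E] (u : G.H1) : ℝ :=
  G.integral fun e x => ‖u.val e x‖ ^ 2

/-- `‖u'‖₂²`. -/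
noncomputable def H1.kinetic [Fintype E] (u : G.H1) : ℝ :=
  G.integral fun e x => ‖u.der e x‖ ^ 2

/-- `‖u‖₆⁶`. -/
noncomputable def H1.potential [Fintype E] (u : G.H1) : ℝ :=
  G.integral fun e x => ‖u.val e x‖ ^ 6

/-- The critical NLS energy `E(u, 𝒢) = ½ ‖u'‖₂² - ⅙ ‖u‖₆⁶`. -/
noncomputable def H1.energy [Fintype E] (u : G.H1) : ℝ :=
  1 / 2 * u.kinetic - 1 / 6 * u.potential

variable (G)

/-- The ground state energy level: the infimum (possibly `-∞`) of the energy over the functions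
in `H¹(𝒢)` of mass `μ`. -/
noncomputable def groundEnergy [Fintype E] (μ : ℝ) : EReal :=
  ⨅ (u : G.H1) (_ : u.mass = μ), (u.energy : EReal)

/-- The level at mass `μ` is attained by some function of mass `μ`. -/
def HasGroundState [Fintype E] (μ : ℝ) : Prop :=
  ∃ u : G.H1, u.mass = μ ∧ (u.energy : EReal) = G.groundEnergy μ

/-- The best constant in the Gagliardo-Nirenberg inequality `‖u‖₆⁶ ≤ C ‖u‖₂⁴ ‖u'‖₂²`. -/
noncomputable def gnConstant [Fintype E] : ℝ :=
  sInf {C : ℝ | 0 ≤ C ∧ ∀ u : G.H1, u.potential ≤ C * u.mass ^ 2 * u.kinetic}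

/-- The critical mass `√(3 / K)`, with `K` the best Gagliardo-Nirenberg constant. -/
noncomputable def criticalMass [Fintype E] : ℝ :=
  √(3 / G.gnConstant)

/-- The star graph: half-lines indexed by `ι` that start at one common vertex `none`. -/
def starGraph (ι : Type*) [Nonempty ι] : MetricGraph (Option ι) ι where
  src _ := none
  tgt := some
  len _ := ⊤
  infinity := Set.range some
  len_pos _ := ENNReal.zero_lt_top
  src_notMem_infinity := by simp
  tgt_mem_infinity_iff := by simp
  existsUnique_edge_of_mem_infinity := by
    rintro _ ⟨i, rfl⟩
    exact ⟨i, rfl, fun j hj => Option.some_injective _ hj⟩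
  infinity_nonempty := Set.range_nonempty _

/-- The half-line `ℝ⁺`, with one vertex at the origin and one at infinity. -/
def halfline : MetricGraph (Option Unit) Unit := starGraph Unit

/-- The real line `ℝ`, made of two half-lines joined at the origin. -/
def line : MetricGraph (Option Bool) Bool := starGraph Bool

end MetricGraph

open Set Filter Topology

/-! Let M be the maximum of |u|, w(s) = b s √(M⁴ - s⁴), and W the primitive of w vanishing at 0.
Expanding ∫ (|u'| - w(|u|))² ≥ 0 bounds 2 ∫ |u'| w(|u|) by ‖u'‖₂² + b² (M⁴ ‖u‖₂² - ‖u‖₆⁶). The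
integral ∫ |u'| w(|u|) controls the total variation of W ∘ |u|. On a connected noncompact graph |u|
takes every value in (0, M), so this variation is at least W(M) = bπM⁴/8; on the line the maximum is
approached from both sides and the bound doubles. Choosing b so that M⁴ cancels gives the
Gagliardo-Nirenberg inequality with constant 16/π² (`H1.potential_le`), and 4/π² on the line
(`line_potential_le`), without any rearrangement.

Half of the soliton sech^{1/2} gives equality with 16/π². Truncated and concentrated at a terminal
point, it fits into one edge, so the best constant is 16/π² (`gnConstant_eq`) and the critical mass
is √3π/4, while that of the line is at least √3π/2. At fixed mass, rescaling by l multiplies the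
energy by l². Above the critical mass, concentrated bumps therefore drive the energy to -∞; at the
critical mass the inequality gives E ≥ 0, and flattening a bump along a half-line gives the level 0.

A minimizer at the critical mass has equality throughout, so |u'| = w(|u|) a.e. Composing |u| with
the inverse soliton profile yields a map onto [0, ∞) that contracts every edge. The image of the
length measure dominates Lebesgue measure; since the minimizer and the soliton have equal mass, a
positive function has the same integral against both, and the two measures agree
(`sum_volume_preimage_eq`). Such a map is isometric on edges and glues only at vertices
(`isHalfline_of_sum_volume_preimage_eq`). Conversely, on a half-line the soliton is a minimizer. -/

/-! ### Variation of functions of |u| along a curve. -/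

/-- If `|W'| ≤ w`, then the increments of `W ∘ ‖u‖` along an absolutely continuous curve `u` are
controlled by the integral of `‖u'‖ w(‖u‖)`. -/
theorem comp_norm_sub_le_integral {u u' : ℝ → ℂ} {a b α β : ℝ} {W W' w : ℝ → ℝ} (hab : a ≤ b)
    (hi : IntervalIntegrable u' volume a b)
    (hu : ∀ x ∈ Icc a b, ∀ y ∈ Icc a b, u y - u x = ∫ t in x..y, u' t)
    (hmem : ∀ t ∈ Icc a b, ‖u t‖ ∈ Icc α β)
    (hW : ∀ s ∈ Icc α β, HasDerivAt W (W' s) s) (hle : ∀ s ∈ Icc α β, |W' s| ≤ w s)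
    (hw : ContinuousOn w (Icc α β)) :
    W ‖u b‖ - W ‖u a‖ ≤ ∫ t in a..b, ‖u' t‖ * w ‖u t‖ := by
  have hii : IntegrableOn u' (Icc a b) := by
    rwa [intervalIntegrable_iff_integrableOn_Icc_of_le hab] at hi
  have hin : IntegrableOn (fun t => ‖u' t‖) (Icc a b) := hii.norm
  have hcu : ContinuousOn u (Icc a b) := by
    have h1 : ContinuousOn (fun y => u a + ∫ t in a..y, u' t) (Icc a b) := by
      have := intervalIntegral.continuousOn_primitive_interval (μ := volume) (f := u') (a := a) (b := b)
        (by rwa [uIcc_of_le hab])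
      rw [uIcc_of_le hab] at this
      exact continuousOn_const.add this
    refine h1.congr fun y hy => ?_
    simp only [← hu a (left_mem_Icc.2 hab) y hy]; ring
  have hcn : ContinuousOn (fun t => ‖u t‖) (Icc a b) := hcu.norm
  have hcw : ContinuousOn (fun t => w ‖u t‖) (Icc a b) := hw.comp hcn hmem
  have hcW : ContinuousOn (fun t => W ‖u t‖) (Icc a b) :=
    ContinuousOn.comp (t := Icc α β) (fun s hs => (hW s hs).continuousAt.continuousWithinAt) hcn hmem
  have hiw : IntegrableOn (fun t => ‖u' t‖ * w ‖u t‖) (Icc a b) :=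
    hin.mul_continuousOn hcw isCompact_Icc
  have hsub : ∀ {f : ℝ → ℝ}, IntegrableOn f (Icc a b) → ∀ {s t : ℝ}, s ∈ Icc a b → t ∈ Icc a b →
      IntervalIntegrable f volume s t := by
    intro f hf s t hs ht
    exact (hf.mono_set (uIcc_subset_Icc hs ht)).intervalIntegrable
  -- No differentiability of ‖u‖ is used: the bound with an extra ε ∫ ‖u'‖ is propagated from a to b
  -- by continuous induction. At each point, ε/2 pays for the linearization of W and ε/2 for the
  -- oscillation of w.
  have key : ∀ ε > 0, W ‖u b‖ - W ‖u a‖ ≤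
      (∫ t in a..b, ‖u' t‖ * w ‖u t‖) + ε * ∫ t in a..b, ‖u' t‖ := by
    intro ε hε
    set s : Set ℝ := {y | W ‖u y‖ - W ‖u a‖ ≤
      (∫ t in a..y, ‖u' t‖ * w ‖u t‖) + ε * ∫ t in a..y, ‖u' t‖} with hs
    have hprim : ∀ {f : ℝ → ℝ}, IntegrableOn f (Icc a b) →
        ContinuousOn (fun y => ∫ t in a..y, f t) (Icc a b) := by
      intro f hf
      have := intervalIntegral.continuousOn_primitive_interval (μ := volume) (f := f) (a := a) (b := b)
        (by rwa [uIcc_of_le hab])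
      rwa [uIcc_of_le hab] at this
    have hclosed : IsClosed (s ∩ Icc a b) := by
      have : s ∩ Icc a b = {y ∈ Icc a b | W ‖u y‖ - W ‖u a‖ ≤
          (∫ t in a..y, ‖u' t‖ * w ‖u t‖) + ε * ∫ t in a..y, ‖u' t‖} := by
        ext; simp [hs, and_comm]
      rw [this]
      exact isClosed_Icc.isClosed_le (hcW.sub continuousOn_const)
        ((hprim hiw).add (continuousOn_const.mul (hprim hin)))
    have hsubset : Icc a b ⊆ s := by
      refine hclosed.Icc_subset_of_forall_exists_gt (by simp [hs]) ?_
      rintro t ⟨hts, ht⟩ y hy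
      have htI : t ∈ Icc a b := ⟨ht.1, ht.2.le⟩
      have hso := hmem t htI
      have hd := hW _ hso
      have h1 : ∀ᶠ r in 𝓝 ‖u t‖, |W r - W ‖u t‖ - (r - ‖u t‖) * W' ‖u t‖| ≤ ε / 2 * |r - ‖u t‖| := by
        have := (hasDerivAt_iff_isLittleO.1 hd).def (half_pos hε)
        simpa using this
      have hnw : 𝓝[>] t = 𝓝[Ioc t b] t := (nhdsWithin_Ioc_eq_nhdsGT ht.2).symm
      have hIoc : Ioc t b ⊆ Icc a b := fun z hz => ⟨ht.1.trans hz.1.le, hz.2⟩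
      have h2 : ∀ᶠ z in 𝓝[>] t, |W ‖u z‖ - W ‖u t‖ - (‖u z‖ - ‖u t‖) * W' ‖u t‖| ≤
          ε / 2 * |‖u z‖ - ‖u t‖| := by
        rw [hnw]
        exact ((hcn t htI).mono hIoc).eventually h1
      have h3 : ∀ᶠ z in 𝓝[Icc a b] t, w ‖u t‖ - ε / 2 < w ‖u z‖ :=
        (hcw t htI).eventually (lt_mem_nhds (by linarith))
      obtain ⟨δ, hδ, h3⟩ := Metric.eventually_nhds_iff.1 (eventually_nhdsWithin_iff.1 h3)
      have h4 : ∀ᶠ z in 𝓝[>] t, z < min (min y b) (t + δ) ∧ t < z := by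
        refine (eventually_nhdsWithin_of_eventually_nhds
          (gt_mem_nhds ?_)).and self_mem_nhdsWithin
        exact lt_min (lt_min hy ht.2) (by linarith)
      obtain ⟨z, hz2, hz4, htz⟩ := (h2.and h4).exists
      have hzI : z ∈ Icc a b := ⟨ht.1.trans htz.le, (hz4.trans_le ((min_le_left _ _).trans
        (min_le_right _ _))).le⟩
      have haI : a ∈ Icc a b := left_mem_Icc.2 hab
      refine ⟨z, ?_, htz, (hz4.trans_le ((min_le_left _ _).trans (min_le_left _ _))).le⟩
      have hdiff : |‖u z‖ - ‖u t‖| ≤ ∫ r in t..z, ‖u' r‖ :=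
        (abs_norm_sub_norm_le _ _).trans (by
          rw [hu t htI z hzI]
          exact intervalIntegral.norm_integral_le_integral_norm htz.le)
      have hstep : W ‖u z‖ - W ‖u t‖ ≤ (w ‖u t‖ + ε / 2) * ∫ r in t..z, ‖u' r‖ := by
        have e1 := (abs_le.1 hz2).2
        have e2 : (‖u z‖ - ‖u t‖) * W' ‖u t‖ ≤ |‖u z‖ - ‖u t‖| * w ‖u t‖ :=
          (le_abs_self _).trans (by
            rw [abs_mul]; exact mul_le_mul_of_nonneg_left (hle _ hso) (abs_nonneg _))
        have e3 : 0 ≤ w ‖u t‖ := (abs_nonneg _).trans (hle _ hso)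
        nlinarith [mul_le_mul_of_nonneg_left hdiff (by linarith : 0 ≤ w ‖u t‖ + ε / 2)]
      have hint : (w ‖u t‖ - ε / 2) * ∫ r in t..z, ‖u' r‖ ≤ ∫ r in t..z, ‖u' r‖ * w ‖u r‖ := by
        rw [← intervalIntegral.integral_const_mul]
        refine intervalIntegral.integral_mono_on htz.le
          ((hsub hin htI hzI).const_mul _) (hsub hiw htI hzI) fun r hr => ?_
        rw [mul_comm]
        refine mul_le_mul_of_nonneg_left (h3 (y := r) ?_ ⟨ht.1.trans hr.1, hr.2.trans hzI.2⟩).le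
          (norm_nonneg _)
        rw [Real.dist_eq, abs_of_nonneg (by linarith [hr.1])]
        have := hz4.trans_le (min_le_right _ _)
        linarith [hr.2]
      have ha1 := intervalIntegral.integral_add_adjacent_intervals
        (hsub hin haI htI) (hsub hin htI hzI)
      have ha2 := intervalIntegral.integral_add_adjacent_intervals
        (hsub hiw haI htI) (hsub hiw htI hzI)
      simp only [hs, mem_ofPred_eq] at hts ⊢
      rw [← ha1, ← ha2]
      linarith
    exact hsubset (right_mem_Icc.2 hab)
  have hlim : Tendsto (fun ε : ℝ => (∫ t in a..b, ‖u' t‖ * w ‖u t‖) + ε * ∫ t in a..b, ‖u' t‖)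
      (𝓝[>] 0) (𝓝 ((∫ t in a..b, ‖u' t‖ * w ‖u t‖) + 0 * ∫ t in a..b, ‖u' t‖)) :=
    (tendsto_const_nhds.add ((continuous_id.tendsto (0 : ℝ)).mul tendsto_const_nhds)).mono_left
      nhdsWithin_le_nhds
  rw [zero_mul, add_zero] at hlim
  exact ge_of_tendsto hlim (eventually_mem_nhdsWithin.mono fun ε hε => key ε hε)

/-- Two-sided form of `comp_norm_sub_le_integral`. -/
theorem abs_comp_norm_sub_le_integral {u u' : ℝ → ℂ} {a b α β : ℝ} {W W' w : ℝ → ℝ} (hab : a ≤ b)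
    (hi : IntervalIntegrable u' volume a b)
    (hu : ∀ x ∈ Icc a b, ∀ y ∈ Icc a b, u y - u x = ∫ t in x..y, u' t)
    (hmem : ∀ t ∈ Icc a b, ‖u t‖ ∈ Icc α β)
    (hW : ∀ s ∈ Icc α β, HasDerivAt W (W' s) s) (hle : ∀ s ∈ Icc α β, |W' s| ≤ w s)
    (hw : ContinuousOn w (Icc α β)) :
    |W ‖u b‖ - W ‖u a‖| ≤ ∫ t in a..b, ‖u' t‖ * w ‖u t‖ := by
  refine abs_le.2 ⟨?_, comp_norm_sub_le_integral hab hi hu hmem hW hle hw⟩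
  have := comp_norm_sub_le_integral (W := fun s => -W s) (W' := fun s => -W' s) hab hi hu hmem
    (fun s hs => (hW s hs).neg) (fun s hs => by simpa using hle s hs) hw
  linarith

/-! ### Edge intervals and continuity of H¹ functions. -/

namespace MetricGraph

variable {V E : Type*} {G : MetricGraph V E}

theorem interval_eq_Icc {e : E} (h : G.len e ≠ ⊤) : G.interval e = Icc 0 (G.len e).toReal := by
  ext x
  simp only [interval, mem_ofPred_eq, mem_Icc]
  exact and_congr_right fun hx => ENNReal.ofReal_le_iff_le_toReal h

theorem interval_eq_Ici {e : E} (h : G.len e = ⊤) : G.interval e = Ici 0 := by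
  ext x
  simp [interval, h]

theorem ordConnected_interval (e : E) : (G.interval e).OrdConnected := by
  by_cases h : G.len e = ⊤
  · rw [interval_eq_Ici h]; exact ordConnected_Ici
  · rw [interval_eq_Icc h]; exact ordConnected_Icc

theorem isClosed_interval (e : E) : IsClosed (G.interval e) := by
  by_cases h : G.len e = ⊤
  · rw [interval_eq_Ici h]; exact isClosed_Ici
  · rw [interval_eq_Icc h]; exact isClosed_Icc

theorem measurableSet_interval (e : E) : MeasurableSet (G.interval e) :=
  (isClosed_interval e).measurableSet

theorem zero_mem_interval (e : E) : (0 : ℝ) ∈ G.interval e := by simp [interval]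

theorem nonneg_of_mem_interval {e : E} {x : ℝ} (h : x ∈ G.interval e) : 0 ≤ x := h.1

theorem toReal_len_pos {e : E} (h : G.len e ≠ ⊤) : 0 < (G.len e).toReal :=
  ENNReal.toReal_pos (G.len_pos e).ne' h

theorem toReal_len_mem_interval {e : E} (h : G.len e ≠ ⊤) : (G.len e).toReal ∈ G.interval e := by
  rw [interval_eq_Icc h]; exact right_mem_Icc.2 ENNReal.toReal_nonneg

theorem exists_pos_mem_interval (e : E) : ∃ d > 0, d ∈ G.interval e := by
  by_cases h : G.len e = ⊤
  · exact ⟨1, one_pos, by rw [interval_eq_Ici h]; exact zero_le_one (α := ℝ)⟩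
  · exact ⟨_, toReal_len_pos h, toReal_len_mem_interval h⟩

theorem IsAt.mem_interval {v : V} {e : E} {x : ℝ} (h : G.IsAt v e x) : x ∈ G.interval e := by
  rcases h with ⟨rfl, -⟩ | ⟨h, rfl, -⟩
  · exact zero_mem_interval e
  · exact toReal_len_mem_interval h

theorem Icc_subset_interval {e : E} {x y : ℝ} (hx : x ∈ G.interval e) (hy : y ∈ G.interval e) :
    Icc x y ⊆ G.interval e :=
  (ordConnected_interval e).out hx hy

namespace H1

variable (u : G.H1)

theorem intervalIntegrable_der (e : E) {x y : ℝ} (hx : x ∈ G.interval e) (hy : y ∈ G.interval e) :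
    IntervalIntegrable (u.der e) volume x y := by
  have hsub : uIcc x y ⊆ G.interval e := (ordConnected_interval e).uIcc_subset hx hy
  have h1 : MemLp (u.der e) 2 (volume.restrict (uIcc x y)) :=
    (u.memLp_der e).mono_measure (Measure.restrict_mono hsub le_rfl)
  have h2 : IntegrableOn (u.der e) (uIcc x y) := by
    have : IsFiniteMeasure (volume.restrict (uIcc x y)) := isFiniteMeasure_restrict.2 (by
      simp [uIcc])
    exact h1.integrable one_le_two
  exact h2.intervalIntegrable

theorem continuousOn_val (e : E) : ContinuousOn (u.val e) (G.interval e) := by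
  intro y hy
  obtain ⟨a, b, ha, hb, hab⟩ : ∃ a b, a ∈ G.interval e ∧ b ∈ G.interval e ∧
      Icc a b ∈ 𝓝[G.interval e] y := by
    by_cases h : G.len e = ⊤
    · rw [interval_eq_Ici h] at hy ⊢
      refine ⟨0, y + 1, self_mem_Ici, ?_, ?_⟩
      · exact mem_Ici.2 (add_nonneg (mem_Ici.1 hy) zero_le_one)
      · rw [mem_nhdsWithin]
        exact ⟨Iio (y + 1), isOpen_Iio, lt_add_one y, fun z hz => ⟨hz.2, hz.1.le⟩⟩
    · refine ⟨0, _, zero_mem_interval e, toReal_len_mem_interval h, ?_⟩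
      rw [interval_eq_Icc h]; exact self_mem_nhdsWithin
  have hle : a ≤ b := by
    by_contra hc
    rw [Icc_eq_empty hc] at hab
    exact (mem_closure_iff_nhdsWithin_neBot.1 (subset_closure hy)).ne (empty_mem_iff_bot.1 hab)
  have hsub := Icc_subset_interval ha hb
  have h1 : ContinuousOn (fun y => u.val e a + ∫ t in a..y, u.der e t) (Icc a b) := by
    have := intervalIntegral.continuousOn_primitive_interval' (u.intervalIntegrable_der e ha hb)
      left_mem_uIcc
    rw [uIcc_of_le hle] at this
    exact continuousOn_const.add this
  have h2 : ContinuousOn (u.val e) (Icc a b) := h1.congr fun y hy => by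
    simp only [← u.val_sub_val e a ha y (hsub hy)]; ring
  have hy' : y ∈ Icc a b := mem_of_mem_nhdsWithin hy hab
  exact (h2 y hy').mono_of_mem_nhdsWithin hab

theorem abs_comp_norm_val_sub_le {α β : ℝ} {W W' w : ℝ → ℝ} (e : E) {a b : ℝ} (hab : a ≤ b)
    (ha : a ∈ G.interval e) (hb : b ∈ G.interval e)
    (hmem : ∀ t ∈ Icc a b, ‖u.val e t‖ ∈ Icc α β)
    (hW : ∀ s ∈ Icc α β, HasDerivAt W (W' s) s) (hle : ∀ s ∈ Icc α β, |W' s| ≤ w s)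
    (hw : ContinuousOn w (Icc α β)) :
    |W ‖u.val e b‖ - W ‖u.val e a‖| ≤ ∫ t in a..b, ‖u.der e t‖ * w ‖u.val e t‖ :=
  abs_comp_norm_sub_le_integral hab (u.intervalIntegrable_der e ha hb)
    (fun x hx y hy => u.val_sub_val e x (Icc_subset_interval ha hb hx) y
      (Icc_subset_interval ha hb hy)) hmem hW hle hw

end H1

end MetricGraph

/-! ### Connectedness, decay on half-lines, and total variation over the graph. -/

namespace MetricGraph

variable {V E : Type*} {G : MetricGraph V E}

theorem exists_infinite_edge (G : MetricGraph V E) : ∃ e, G.len e = ⊤ := by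
  obtain ⟨v, hv⟩ := G.infinity_nonempty
  obtain ⟨e, he, -⟩ := G.existsUnique_edge_of_mem_infinity v hv
  exact ⟨e, (G.tgt_mem_infinity_iff e).1 (he ▸ hv)⟩

theorem exists_isAt_of_incident {v : V} (hv : v ∉ G.infinity) {e : E}
    (h : G.src e = v ∨ G.tgt e = v) : ∃ x, G.IsAt v e x := by
  rcases h with h | h
  · exact ⟨0, Or.inl ⟨rfl, h⟩⟩
  · exact ⟨_, Or.inr ⟨fun hl => hv (h ▸ (G.tgt_mem_infinity_iff e).2 hl), rfl, h⟩⟩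

/-- In a connected metric graph, a property of edges that is shared by the edges meeting at a
vertex holds on all edges or on none. -/
theorem Connected.forall_edge (hconn : G.Connected) {A : E → Prop}
    (hA : ∀ v e x e' x', G.IsAt v e x → G.IsAt v e' x' → A e → A e') {e₀ : E} (h₀ : A e₀) (e : E) :
    A e := by
  have hA' : ∀ v e e', (G.src e = v ∨ G.tgt e = v) → (G.src e' = v ∨ G.tgt e' = v) →
      A e → A e' := by
    intro v e e' he he' h
    by_cases hv : v ∈ G.infinity
    -- `IsAt` does not see vertices at infinity, but only one edge ends there, so the two edges
    -- coincide.
    · have aux : ∀ f, (G.src f = v ∨ G.tgt f = v) → G.tgt f = v := fun f hf =>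
        hf.resolve_left fun hs => G.src_notMem_infinity f (hs ▸ hv)
      rwa [(G.existsUnique_edge_of_mem_infinity v hv).unique (aux e' he') (aux e he)]
    · obtain ⟨x, hx⟩ := exists_isAt_of_incident hv he
      obtain ⟨x', hx'⟩ := exists_isAt_of_incident hv he'
      exact hA v e x e' x' hx hx' h
  have hreach := (SimpleGraph.reachable_iff_reflTransGen _ _).1
    (hconn.preconnected (G.src e₀) (G.src e))
  have key : ∀ w, Relation.ReflTransGen
      (SimpleGraph.fromRel fun v w : V => ∃ e, G.src e = v ∧ G.tgt e = w).Adj (G.src e₀) w →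
      ∀ f, (G.src f = w ∨ G.tgt f = w) → A f := by
    intro w hw
    induction hw with
    | refl => exact fun f hf => hA' _ e₀ f (Or.inl rfl) hf h₀
    | @tail b c _ hbc ih =>
      intro f hf
      rw [SimpleGraph.fromRel_adj] at hbc
      rcases hbc.2 with ⟨f', h1, h2⟩ | ⟨f', h1, h2⟩
      · exact hA' c f' f (Or.inr h2) hf (ih f' (Or.inl h1))
      · exact hA' c f' f (Or.inl h1) hf (ih f' (Or.inr h2))
  exact key _ hreach e (Or.inl rfl)

namespace H1

variable (u : G.H1)

theorem integrableOn_norm_val_sq (e : E) :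
    IntegrableOn (fun x => ‖u.val e x‖ ^ 2) (G.interval e) :=
  (u.memLp_val e).integrable_norm_pow two_ne_zero

theorem integrableOn_norm_der_sq (e : E) :
    IntegrableOn (fun x => ‖u.der e x‖ ^ 2) (G.interval e) :=
  (u.memLp_der e).integrable_norm_pow two_ne_zero

theorem integrableOn_norm_der_mul_norm_val (e : E) :
    IntegrableOn (fun x => ‖u.der e x‖ * ‖u.val e x‖) (G.interval e) :=
  (u.memLp_der e).norm.integrable_mul (u.memLp_val e).norm

/-- Otherwise ‖u‖² would be at least δ² on a set of infinite measure, against integrability. -/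
theorem exists_norm_val_lt {e : E} (he : G.len e = ⊤) (x : ℝ) {δ : ℝ} (hδ : 0 < δ) :
    ∃ y, x ≤ y ∧ 0 ≤ y ∧ ‖u.val e y‖ < δ := by
  by_contra! hc
  have h1 := (u.integrableOn_norm_val_sq e).measure_norm_ge_lt_top (sq_pos_of_pos hδ)
  rw [interval_eq_Ici he] at h1
  have h2 : Ici (max x 0) ⊆ {y | δ ^ 2 ≤ ‖‖u.val e y‖ ^ 2‖} ∩ Ici 0 := fun y hy => by
    have hy' := max_le_iff.1 (mem_Ici.1 hy)
    refine ⟨?_, mem_Ici.2 hy'.2⟩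
    simp only [mem_ofPred_eq, norm_pow, norm_norm]
    exact pow_le_pow_left₀ hδ.le (hc y hy'.1 hy'.2) 2
  have h3 := (measure_mono (μ := volume) h2).trans (Measure.le_restrict_apply _ _)
  rw [Real.volume_Ici] at h3
  exact absurd (h3.trans_lt h1) (lt_irrefl _)

/-- Along a half-line, a primitive of the weight is controlled up to infinity. -/
theorem comp_norm_val_le_integral_Ioi {e : E} (he : G.len e = ⊤) {W w : ℝ → ℝ} (hw : Continuous w)
    (hw0 : ∀ s, 0 ≤ s → 0 ≤ w s) (hW : ∀ s, HasDerivAt W (w s) s) (hW0 : W 0 = 0)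
    (hi : IntegrableOn (fun t => ‖u.der e t‖ * w ‖u.val e t‖) (G.interval e))
    {x : ℝ} (hx : 0 ≤ x) :
    W ‖u.val e x‖ ≤ ∫ t in Ioi x, ‖u.der e t‖ * w ‖u.val e t‖ := by
  rw [interval_eq_Ici he] at hi
  refine le_of_forall_pos_le_add fun η hη => ?_
  have h1 : ∀ᶠ s in 𝓝 (0 : ℝ), W s < η :=
    (hW 0).continuousAt.eventually (gt_mem_nhds (by rwa [hW0]))
  obtain ⟨δ, hδ, h1⟩ := Metric.eventually_nhds_iff.1 h1
  obtain ⟨y, hxy, hy, hlt⟩ := u.exists_norm_val_lt he x hδ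
  have h2 : W ‖u.val e y‖ < η := h1 (by simpa using hlt)
  have hmx : x ∈ G.interval e := by rw [interval_eq_Ici he]; exact hx
  have hmy : y ∈ G.interval e := by rw [interval_eq_Ici he]; exact hy
  obtain ⟨C, hC⟩ := (isCompact_Icc.bddAbove_image
    ((u.continuousOn_val e).mono (Icc_subset_interval hmx hmy)).norm)
  have h3 := u.abs_comp_norm_val_sub_le (α := 0) (β := C) (W := W) (W' := w) (w := w) e hxy hmx hmy
    (fun t ht => ⟨norm_nonneg _, hC (mem_image_of_mem _ ht)⟩) (fun s _ => hW s)
    (fun s hs => (abs_of_nonneg (hw0 s hs.1)).le) hw.continuousOn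
  have h4 : ∫ t in x..y, ‖u.der e t‖ * w ‖u.val e t‖ ≤ ∫ t in Ioi x, ‖u.der e t‖ * w ‖u.val e t‖ := by
    rw [intervalIntegral.integral_of_le hxy]
    refine setIntegral_mono_set (hi.mono_set fun t ht => mem_Ici.2 (hx.trans (mem_Ioi.1 ht).le))
      (ae_of_all _ fun t => mul_nonneg (norm_nonneg _) (hw0 _ (norm_nonneg _)))
      (Ioc_subset_Ioi_self).eventuallyLE
  have := (abs_le.1 h3).1
  linarith

theorem norm_val_sq_le_integral_Ioi {e : E} (he : G.len e = ⊤) {x : ℝ} (hx : 0 ≤ x) :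
    ‖u.val e x‖ ^ 2 ≤ ∫ t in Ioi x, ‖u.der e t‖ * (2 * ‖u.val e t‖) := by
  refine u.comp_norm_val_le_integral_Ioi he (W := fun s => s ^ 2) (w := fun s => 2 * s)
    (by fun_prop) (fun s hs => by positivity) (fun s => by simpa using hasDerivAt_pow 2 s) (by simp)
    ?_ hx
  refine ((u.integrableOn_norm_der_mul_norm_val e).const_mul 2).congr (ae_of_all _ fun t => ?_)
  simp only; ring

/-- By `norm_val_sq_le_integral_Ioi`, ‖u‖² is bounded by the tail of a convergent integral. This
uniform decay is what makes the maximum attained on a half-line. -/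
theorem exists_forall_ge_norm_val_lt {e : E} (he : G.len e = ⊤) {δ : ℝ} (hδ : 0 < δ) :
    ∃ R, 0 ≤ R ∧ ∀ x, R ≤ x → ‖u.val e x‖ < δ := by
  have hi : IntegrableOn (fun t => ‖u.der e t‖ * (2 * ‖u.val e t‖)) (Ioi 0) := by
    have := u.integrableOn_norm_der_mul_norm_val e
    rw [interval_eq_Ici he] at this
    refine ((this.mono_set Ioi_subset_Ici_self).const_mul 2).congr (ae_of_all _ fun t => ?_)
    simp only; ring
  have h1 := intervalIntegral_tendsto_integral_Ioi 0 hi tendsto_id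
  have h2 : ∀ᶠ x in atTop, (∫ t in Ioi 0, ‖u.der e t‖ * (2 * ‖u.val e t‖)) - δ ^ 2 <
      ∫ t in (0 : ℝ)..id x, ‖u.der e t‖ * (2 * ‖u.val e t‖) :=
    h1.eventually (lt_mem_nhds (by linarith [sq_pos_of_pos hδ]))
  obtain ⟨R, hR⟩ := eventually_atTop.1 (h2.and (eventually_ge_atTop 0))
  refine ⟨max R 0, le_max_right _ _, fun x hx => ?_⟩
  obtain ⟨h3, h4⟩ := hR x ((le_max_left _ _).trans hx)
  have h5 := u.norm_val_sq_le_integral_Ioi he h4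
  have h6 := intervalIntegral.integral_Ioi_sub_Ioi hi h4
  simp only [id] at h3
  exact lt_of_pow_lt_pow_left₀ 2 hδ.le (by linarith)

theorem exists_isMaxOn_norm_val (e : E) :
    ∃ x ∈ G.interval e, ∀ y ∈ G.interval e, ‖u.val e y‖ ≤ ‖u.val e x‖ := by
  by_cases he : G.len e = ⊤
  · by_cases h0 : ∀ y ∈ G.interval e, u.val e y = 0
    · exact ⟨0, zero_mem_interval e, fun y hy => by rw [h0 y hy, h0 0 (zero_mem_interval e)]⟩
    · push Not at h0
      obtain ⟨y₀, hy₀, hne⟩ := h0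
      obtain ⟨R, hR0, hR⟩ := u.exists_forall_ge_norm_val_lt he (norm_pos_iff.2 hne)
      obtain ⟨x, hx, hmax⟩ := isCompact_Icc.exists_isMaxOn (nonempty_Icc.2 hR0)
        ((u.continuousOn_val e).norm.mono (Icc_subset_interval (zero_mem_interval e)
          (by rw [interval_eq_Ici he]; exact hR0)))
      have hy₀R : y₀ ≤ R := by
        by_contra! hc
        exact lt_irrefl _ (hR y₀ hc.le)
      have hx0 : ‖u.val e y₀‖ ≤ ‖u.val e x‖ := hmax ⟨nonneg_of_mem_interval hy₀, hy₀R⟩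
      refine ⟨x, by rw [interval_eq_Ici he]; exact hx.1, fun y hy => ?_⟩
      rcases le_total y R with h | h
      · exact hmax ⟨nonneg_of_mem_interval hy, h⟩
      · exact (hR y h).le.trans hx0
  · have hc : IsCompact (G.interval e) := by rw [interval_eq_Icc he]; exact isCompact_Icc
    obtain ⟨x, hx, hmax⟩ := hc.exists_isMaxOn ⟨0, zero_mem_interval e⟩ (u.continuousOn_val e).norm
    exact ⟨x, hx, fun y hy => hmax hy⟩

theorem exists_max_norm_val [Finite E] :
    ∃ e₀, ∃ x₀ ∈ G.interval e₀, ∀ e, ∀ x ∈ G.interval e, ‖u.val e x‖ ≤ ‖u.val e₀ x₀‖ := by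
  choose m hm hmax using u.exists_isMaxOn_norm_val
  have : Nonempty E := (exists_infinite_edge G).nonempty
  obtain ⟨e₀, h₀⟩ := Finite.exists_max fun e => ‖u.val e (m e)‖
  exact ⟨e₀, m e₀, hm e₀, fun e x hx => (hmax e x hx).trans (h₀ e)⟩

/-- If t were missed, the intermediate value theorem would keep each edge on one side of t. Since
edges share values at vertices, all of them would lie above t, against decay on a half-line. -/
theorem exists_norm_val_eq (hconn : G.Connected) {t : ℝ} (ht : 0 < t) {e₀ : E} {x₀ : ℝ}
    (hx₀ : x₀ ∈ G.interval e₀) (hle : t ≤ ‖u.val e₀ x₀‖) :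
    ∃ e, ∃ x ∈ G.interval e, ‖u.val e x‖ = t := by
  by_contra! hc
  have hside : ∀ e, ∀ x ∈ G.interval e, t < ‖u.val e x‖ → ∀ y ∈ G.interval e, t < ‖u.val e y‖ := by
    intro e x hx hlt y hy
    by_contra! hle
    obtain ⟨z, hz, hzt⟩ := (ordConnected_interval (G := G) e).isPreconnected.intermediate_value hy hx
      (u.continuousOn_val e).norm ⟨hle, hlt.le⟩
    exact hc e z hz hzt
  have hall := hconn.forall_edge (A := fun e => ∀ y ∈ G.interval e, t < ‖u.val e y‖)
    (fun v e x e' x' h h' hA => hside e' x' h'.mem_interval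
      (u.continuous_vertex v e x e' x' h h' ▸ hA x h.mem_interval))
    (hside e₀ x₀ hx₀ (lt_of_le_of_ne hle (hc e₀ x₀ hx₀).symm))
  obtain ⟨e, he⟩ := exists_infinite_edge G
  obtain ⟨y, -, hy, hlt⟩ := u.exists_norm_val_lt he 0 ht
  exact lt_asymm hlt (hall e y (by rw [interval_eq_Ici he]; exact hy))

theorem abs_comp_norm_val_sub_le_setIntegral {W w : ℝ → ℝ} (hw : Continuous w)
    (hw0 : ∀ s, 0 ≤ s → 0 ≤ w s) (hW : ∀ s, HasDerivAt W (w s) s) (e : E)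
    (hi : IntegrableOn (fun t => ‖u.der e t‖ * w ‖u.val e t‖) (G.interval e))
    {x y : ℝ} (hx : x ∈ G.interval e) (hy : y ∈ G.interval e) :
    |W ‖u.val e x‖ - W ‖u.val e y‖| ≤ ∫ t in G.interval e, ‖u.der e t‖ * w ‖u.val e t‖ := by
  wlog hxy : y ≤ x generalizing x y
  · rw [abs_sub_comm]
    exact this hy hx (le_of_not_ge hxy)
  obtain ⟨C, hC⟩ := (isCompact_Icc.bddAbove_image
    ((u.continuousOn_val e).mono (Icc_subset_interval hy hx)).norm)
  refine (u.abs_comp_norm_val_sub_le (α := 0) (β := C) (W := W) (W' := w) (w := w) e hxy hy hx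
    (fun t ht => ⟨norm_nonneg _, hC (mem_image_of_mem _ ht)⟩) (fun s _ => hW s)
    (fun s hs => (abs_of_nonneg (hw0 s hs.1)).le) hw.continuousOn).trans ?_
  rw [intervalIntegral.integral_of_le hxy]
  exact setIntegral_mono_set hi
    (ae_of_all _ fun t => mul_nonneg (norm_nonneg _) (hw0 _ (norm_nonneg _)))
    (Ioc_subset_Icc_self.trans (Icc_subset_interval hy hx)).eventuallyLE

/-- All values between `0` and `‖u‖` at a point are attained, so the total variation of `W ∘ ‖u‖`
is at least its value at the point. -/
theorem comp_norm_val_le_integral [Fintype E] (hconn : G.Connected) {W w : ℝ → ℝ}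
    (hw : Continuous w) (hw0 : ∀ s, 0 ≤ s → 0 ≤ w s) (hW : ∀ s, HasDerivAt W (w s) s)
    (hW0 : W 0 = 0)
    (hi : ∀ e, IntegrableOn (fun t => ‖u.der e t‖ * w ‖u.val e t‖) (G.interval e))
    {e₀ : E} {x₀ : ℝ} (hx₀ : x₀ ∈ G.interval e₀) :
    W ‖u.val e₀ x₀‖ ≤ G.integral fun e t => ‖u.der e t‖ * w ‖u.val e t‖ := by
  have hnonneg : ∀ e, 0 ≤ ∫ t in G.interval e, ‖u.der e t‖ * w ‖u.val e t‖ := fun e =>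
    integral_nonneg fun t => mul_nonneg (norm_nonneg _) (hw0 _ (norm_nonneg _))
  have hcW : Continuous W := continuous_iff_continuousAt.2 fun s => (hW s).continuousAt
  -- Comparing lengths replaces any choice of a path to infinity: the edge images cover the
  -- interval, and each has length at most its diameter, hence at most the variation on that edge.
  have hcover : Ioo 0 (W ‖u.val e₀ x₀‖) ⊆ ⋃ e, (fun x => W ‖u.val e x‖) '' G.interval e := by
    intro τ hτ
    obtain ⟨s, hs, rfl⟩ := intermediate_value_Icc (norm_nonneg (u.val e₀ x₀)) hcW.continuousOn
      (show τ ∈ Icc (W 0) _ by rw [hW0]; exact ⟨hτ.1.le, hτ.2.le⟩)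
    have hs0 : 0 < s := hs.1.lt_of_ne (by rintro rfl; exact (hW0 ▸ hτ.1).false)
    obtain ⟨e, x, hx, hxs⟩ := u.exists_norm_val_eq hconn hs0 hx₀ hs.2
    exact mem_iUnion.2 ⟨e, x, hx, by simp only [hxs]⟩
  have h1 := (measure_mono (μ := volume) hcover).trans (measure_iUnion_le _)
  rw [Real.volume_Ioo, sub_zero, tsum_fintype] at h1
  have h2 : ∀ e, volume ((fun x => W ‖u.val e x‖) '' G.interval e) ≤
      ENNReal.ofReal (∫ t in G.interval e, ‖u.der e t‖ * w ‖u.val e t‖) := by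
    intro e
    refine (Real.volume_le_diam _).trans (Metric.ediam_le ?_)
    rintro _ ⟨x, hx, rfl⟩ _ ⟨y, hy, rfl⟩
    rw [edist_dist, Real.dist_eq]
    exact ENNReal.ofReal_le_ofReal
      (u.abs_comp_norm_val_sub_le_setIntegral hw hw0 hW e (hi e) hx hy)
  have h3 := h1.trans (Finset.sum_le_sum fun e _ => h2 e)
  rw [← ENNReal.ofReal_sum_of_nonneg fun e _ => hnonneg e] at h3
  exact (ENNReal.ofReal_le_ofReal_iff (Finset.sum_nonneg fun e _ => hnonneg e)).1 h3

end H1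

end MetricGraph

/-! ### The sharp Gagliardo-Nirenberg inequality. -/

/-- The weight `b s √(M⁴ - s⁴)`; solitons satisfy `|φ'| = b φ √(M⁴ - φ⁴)`. -/
noncomputable def solitonWeight (b M s : ℝ) : ℝ := b * s * √(M ^ 4 - s ^ 4)

theorem continuous_solitonWeight (b M : ℝ) : Continuous (solitonWeight b M) := by
  unfold solitonWeight; fun_prop

theorem solitonWeight_nonneg {b : ℝ} (hb : 0 ≤ b) (M : ℝ) {s : ℝ} (hs : 0 ≤ s) :
    0 ≤ solitonWeight b M s := by
  unfold solitonWeight; positivity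

theorem solitonWeight_sq {b M s : ℝ} (h : s ^ 4 ≤ M ^ 4) :
    solitonWeight b M s ^ 2 = b ^ 2 * (M ^ 4 * s ^ 2 - s ^ 6) := by
  unfold solitonWeight
  rw [mul_pow, Real.sq_sqrt (sub_nonneg.2 h)]; ring

theorem solitonWeight_le {b : ℝ} (hb : 0 ≤ b) (M : ℝ) {s : ℝ} (hs : 0 ≤ s) :
    solitonWeight b M s ≤ b * M ^ 2 * s := by
  have h : √(M ^ 4 - s ^ 4) ≤ M ^ 2 := Real.sqrt_le_iff.2 ⟨by positivity, by
    nlinarith [pow_nonneg hs 4]⟩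
  unfold solitonWeight
  nlinarith [mul_le_mul_of_nonneg_left h (mul_nonneg hb hs)]

/-- With r = s² the integral is b/2 times the area of a quarter disc of radius M². The arcsine in
the primitive is not differentiable at s = M, so derivatives are taken only in the open interval. -/
theorem integral_solitonWeight (b : ℝ) {M : ℝ} (hM : 0 < M) :
    ∫ s in (0 : ℝ)..M, solitonWeight b M s = b * Real.pi * M ^ 4 / 8 := by
  have hc : Continuous fun s : ℝ => b / 4 * (s ^ 2 * √(M ^ 4 - s ^ 4) +
      M ^ 4 * Real.arcsin (s ^ 2 / M ^ 2)) := by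
    have := Real.continuous_arcsin
    fun_prop
  have hder : ∀ s ∈ Ioo 0 M, HasDerivAt (fun s : ℝ => b / 4 * (s ^ 2 * √(M ^ 4 - s ^ 4) +
      M ^ 4 * Real.arcsin (s ^ 2 / M ^ 2))) (solitonWeight b M s) s := by
    intro s hs
    have h4 : s ^ 4 < M ^ 4 := pow_lt_pow_left₀ hs.2 hs.1.le (by norm_num)
    have h2 : s ^ 2 < M ^ 2 := pow_lt_pow_left₀ hs.2 hs.1.le (by norm_num)
    have hlt : s ^ 2 / M ^ 2 < 1 := (div_lt_one (by positivity)).2 h2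
    have hge : 0 ≤ s ^ 2 / M ^ 2 := by positivity
    have hpos : 0 < M ^ 4 - s ^ 4 := sub_pos.2 h4
    have d1 := ((hasDerivAt_pow 4 s).const_sub (M ^ 4)).sqrt hpos.ne'
    have d2 := (Real.hasDerivAt_arcsin (x := s ^ 2 / M ^ 2) (by linarith) hlt.ne).comp s
      ((hasDerivAt_pow 2 s).div_const (M ^ 2))
    have d3 := (((hasDerivAt_pow 2 s).mul d1).add (d2.const_mul (M ^ 4))).const_mul (b / 4)
    have hr : √(1 - (s ^ 2 / M ^ 2) ^ 2) = √(M ^ 4 - s ^ 4) / M ^ 2 := by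
      rw [show 1 - (s ^ 2 / M ^ 2) ^ 2 = (M ^ 4 - s ^ 4) / (M ^ 2) ^ 2 by field_simp,
        Real.sqrt_div hpos.le, Real.sqrt_sq (by positivity)]
    refine d3.congr_deriv ?_
    have hs0 : √(M ^ 4 - s ^ 4) ≠ 0 := (Real.sqrt_pos.2 hpos).ne'
    have hsq := Real.sq_sqrt hpos.le
    rw [hr, solitonWeight]
    generalize √(M ^ 4 - s ^ 4) = r at *
    field_simp
    push_cast
    ring_nf
    ring_nf at hsq
    rw [hsq]; ring
  rw [intervalIntegral.integral_eq_sub_of_hasDerivAt_of_le hM.le hc.continuousOn hder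
    ((continuous_solitonWeight b M).intervalIntegrable _ _)]
  have : M ^ 2 / M ^ 2 = 1 := div_self (by positivity)
  simp [this]; ring

namespace MetricGraph

variable {V E : Type*} {G : MetricGraph V E}

theorem integral_nonneg_of_nonneg [Fintype E] {f : E → ℝ → ℝ} (hf : ∀ e x, 0 ≤ f e x) :
    0 ≤ G.integral f :=
  Finset.sum_nonneg fun e _ => integral_nonneg fun x => hf e x

namespace H1

variable (u : G.H1)

theorem integrableOn_norm_val_pow_six (e : E) :
    IntegrableOn (fun x => ‖u.val e x‖ ^ 6) (G.interval e) := by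
  obtain ⟨x₀, -, hmax⟩ := u.exists_isMaxOn_norm_val e
  refine ((u.integrableOn_norm_val_sq e).const_mul (‖u.val e x₀‖ ^ 4)).mono'
    ((u.memLp_val e).1.norm.pow 6) ?_
  filter_upwards [ae_restrict_mem (measurableSet_interval e)] with x hx
  rw [Real.norm_of_nonneg (by positivity), show ‖u.val e x‖ ^ 6 = ‖u.val e x‖ ^ 4 * ‖u.val e x‖ ^ 2
    by ring]
  gcongr
  exact hmax x hx

theorem integrableOn_norm_der_mul_solitonWeight {b : ℝ} (hb : 0 ≤ b) (M : ℝ) (e : E) :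
    IntegrableOn (fun x => ‖u.der e x‖ * solitonWeight b M ‖u.val e x‖) (G.interval e) := by
  refine ((u.integrableOn_norm_der_mul_norm_val e).const_mul (b * M ^ 2)).mono'
    ((u.memLp_der e).1.norm.mul
      ((continuous_solitonWeight b M).comp_aestronglyMeasurable (u.memLp_val e).1.norm))
    (ae_of_all _ fun x => ?_)
  rw [Real.norm_of_nonneg (mul_nonneg (norm_nonneg _) (solitonWeight_nonneg hb M (norm_nonneg _)))]
  nlinarith [mul_le_mul_of_nonneg_left (solitonWeight_le hb M (norm_nonneg (u.val e x)))
    (norm_nonneg (u.der e x))]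

variable {u} in
theorem sq_sub_solitonWeight_eq {b M : ℝ} (hM : ∀ e, ∀ x ∈ G.interval e, ‖u.val e x‖ ≤ M) {e : E}
    {x : ℝ} (hx : x ∈ G.interval e) :
    (‖u.der e x‖ - solitonWeight b M ‖u.val e x‖) ^ 2 = ‖u.der e x‖ ^ 2 +
      b ^ 2 * (M ^ 4 * ‖u.val e x‖ ^ 2 - ‖u.val e x‖ ^ 6) -
      2 * (‖u.der e x‖ * solitonWeight b M ‖u.val e x‖) := by
  rw [← solitonWeight_sq (pow_le_pow_left₀ (norm_nonneg _) (hM e x hx) 4)]; ring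

theorem integrableOn_sq_sub_solitonWeight {b M : ℝ} (hb : 0 ≤ b)
    (hM : ∀ e, ∀ x ∈ G.interval e, ‖u.val e x‖ ≤ M) (e : E) :
    IntegrableOn (fun x => (‖u.der e x‖ - solitonWeight b M ‖u.val e x‖) ^ 2) (G.interval e) := by
  refine (((u.integrableOn_norm_der_sq e).add ((((u.integrableOn_norm_val_sq e).const_mul
    (M ^ 4)).sub (u.integrableOn_norm_val_pow_six e)).const_mul (b ^ 2))).sub
    ((u.integrableOn_norm_der_mul_solitonWeight hb M e).const_mul 2)).congr ?_
  filter_upwards [ae_restrict_mem (measurableSet_interval e)] with x hx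
  rw [sq_sub_solitonWeight_eq hM hx]
  simp

variable [Fintype E]

/-- Nonnegativity of this square gives the inequality; its vanishing gives the soliton equation for
minimizers. -/
theorem integral_sq_sub_solitonWeight {b M : ℝ} (hb : 0 ≤ b)
    (hM : ∀ e, ∀ x ∈ G.interval e, ‖u.val e x‖ ≤ M) :
    G.integral (fun e x => (‖u.der e x‖ - solitonWeight b M ‖u.val e x‖) ^ 2) =
      u.kinetic + b ^ 2 * (M ^ 4 * u.mass - u.potential) -
        2 * G.integral (fun e x => ‖u.der e x‖ * solitonWeight b M ‖u.val e x‖) := by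
  simp only [integral, kinetic, mass, potential, Finset.mul_sum, ← Finset.sum_sub_distrib,
    ← Finset.sum_add_distrib]
  refine Finset.sum_congr rfl fun e _ => ?_
  rw [setIntegral_congr_fun (measurableSet_interval e) fun x hx => sq_sub_solitonWeight_eq hM hx]
  have i1 := u.integrableOn_norm_der_sq e
  have i2 := u.integrableOn_norm_val_sq e
  have i3 := u.integrableOn_norm_val_pow_six e
  have i4 := u.integrableOn_norm_der_mul_solitonWeight hb M e
  have i5 : IntegrableOn (fun x => b ^ 2 * (M ^ 4 * ‖u.val e x‖ ^ 2 - ‖u.val e x‖ ^ 6))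
      (G.interval e) := ((i2.const_mul _).sub i3).const_mul _
  have i6 : IntegrableOn (fun x => ‖u.der e x‖ ^ 2 +
      b ^ 2 * (M ^ 4 * ‖u.val e x‖ ^ 2 - ‖u.val e x‖ ^ 6)) (G.interval e) := i1.add i5
  rw [integral_sub i6 (i4.const_mul 2), integral_add i1 i5, integral_const_mul,
    integral_const_mul, integral_sub (i2.const_mul _) i3, integral_const_mul]

theorem mass_nonneg : 0 ≤ u.mass :=
  G.integral_nonneg_of_nonneg fun _ _ => by positivity

theorem kinetic_nonneg : 0 ≤ u.kinetic :=
  G.integral_nonneg_of_nonneg fun _ _ => by positivity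

theorem potential_le_of_norm_le {M : ℝ} (hM : ∀ e, ∀ x ∈ G.interval e, ‖u.val e x‖ ≤ M) :
    u.potential ≤ M ^ 4 * u.mass := by
  simp only [integral, mass, potential, Finset.mul_sum]
  refine Finset.sum_le_sum fun e _ => ?_
  rw [← integral_const_mul]
  refine setIntegral_mono_on (u.integrableOn_norm_val_pow_six e)
    ((u.integrableOn_norm_val_sq e).const_mul _) (measurableSet_interval e) fun x hx => ?_
  rw [show ‖u.val e x‖ ^ 6 = ‖u.val e x‖ ^ 4 * ‖u.val e x‖ ^ 2 by ring]
  gcongr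
  exact hM e x hx

/-- If the weighted variation of `‖u‖` is at least `n` times that of a decreasing function, then
the Gagliardo-Nirenberg inequality holds with constant `(4 / (n π))²`. -/
theorem potential_le_of_mul_integral_le {n M : ℝ} (hn : 0 < n)
    (hM : ∀ e, ∀ x ∈ G.interval e, ‖u.val e x‖ ≤ M)
    (h : ∀ b, 0 < b → n * (b * Real.pi * M ^ 4 / 8) ≤
      G.integral fun e x => ‖u.der e x‖ * solitonWeight b M ‖u.val e x‖) :
    u.potential ≤ (4 / (n * Real.pi)) ^ 2 * u.mass ^ 2 * u.kinetic := by
  have hpi := Real.pi_pos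
  rcases u.mass_nonneg.eq_or_lt with h0 | hm
  · have := u.potential_le_of_norm_le hM
    rw [← h0] at this ⊢
    simpa using this
  -- This is the value of b for which the two terms in M⁴, namely 2n bπM⁴/8 and b² M⁴ mass, cancel.
  · have hb : 0 < n * Real.pi / (4 * u.mass) := by positivity
    have h1 := h _ hb
    have h2 := u.integral_sq_sub_solitonWeight hb.le hM
    have h3 : 0 ≤ G.integral fun e x =>
        (‖u.der e x‖ - solitonWeight (n * Real.pi / (4 * u.mass)) M ‖u.val e x‖) ^ 2 :=
      G.integral_nonneg_of_nonneg fun _ _ => sq_nonneg _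
    have h4 : 2 * (n * (n * Real.pi / (4 * u.mass) * Real.pi * M ^ 4 / 8)) =
        (n * Real.pi / (4 * u.mass)) ^ 2 * (M ^ 4 * u.mass) := by field_simp; ring
    have h5 : (n * Real.pi / (4 * u.mass)) ^ 2 * u.potential ≤ u.kinetic := by linarith
    have h6 : u.potential = (4 / (n * Real.pi)) ^ 2 * u.mass ^ 2 *
        ((n * Real.pi / (4 * u.mass)) ^ 2 * u.potential) := by field_simp
    rw [h6]
    gcongr

theorem primitive_solitonWeight_hasDerivAt (b M s : ℝ) :
    HasDerivAt (fun s => ∫ r in (0 : ℝ)..s, solitonWeight b M r) (solitonWeight b M s) s :=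
  intervalIntegral.integral_hasDerivAt_right
    ((continuous_solitonWeight b M).intervalIntegrable _ _)
    (continuous_solitonWeight b M).aestronglyMeasurable.stronglyMeasurableAtFilter
    (continuous_solitonWeight b M).continuousAt

/-- The values from 0 to the height at the point are swept at least once, which is the case n = 1 on
every connected graph. -/
theorem le_integral_norm_der_mul_solitonWeight (hconn : G.Connected) {b : ℝ} (hb : 0 ≤ b)
    {e₀ : E} {x₀ : ℝ} (hx₀ : x₀ ∈ G.interval e₀) :
    b * Real.pi * ‖u.val e₀ x₀‖ ^ 4 / 8 ≤
      G.integral fun e x => ‖u.der e x‖ * solitonWeight b ‖u.val e₀ x₀‖ ‖u.val e x‖ := by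
  rcases (norm_nonneg (u.val e₀ x₀)).eq_or_lt with h0 | hM
  · rw [← h0]
    simpa using G.integral_nonneg_of_nonneg (f := fun e x =>
      ‖u.der e x‖ * solitonWeight b 0 ‖u.val e x‖) fun e x =>
      mul_nonneg (norm_nonneg _) (solitonWeight_nonneg hb _ (norm_nonneg _))
  · rw [← integral_solitonWeight b hM]
    exact u.comp_norm_val_le_integral hconn
      (W := fun s => ∫ r in (0 : ℝ)..s, solitonWeight b ‖u.val e₀ x₀‖ r)
      (continuous_solitonWeight b _) (fun s hs => solitonWeight_nonneg hb _ hs)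
      (primitive_solitonWeight_hasDerivAt b _) (by simp)
      (u.integrableOn_norm_der_mul_solitonWeight hb _) hx₀

/-- The Gagliardo-Nirenberg inequality on a connected noncompact metric graph, with the sharp
constant of the half-line. -/
theorem potential_le (hconn : G.Connected) :
    u.potential ≤ 16 / Real.pi ^ 2 * u.mass ^ 2 * u.kinetic := by
  obtain ⟨e₀, x₀, hx₀, hmax⟩ := u.exists_max_norm_val
  have := u.potential_le_of_mul_integral_le (n := 1) one_pos hmax fun b hb => by
    rw [one_mul]; exact u.le_integral_norm_der_mul_solitonWeight hconn hb.le hx₀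
  rwa [one_mul, div_pow, show (4 : ℝ) ^ 2 = 16 by norm_num] at this

end H1

/-- The Gagliardo-Nirenberg inequality on the line. -/
theorem line_potential_le (u : line.H1) :
    u.potential ≤ 4 / Real.pi ^ 2 * u.mass ^ 2 * u.kinetic := by
  obtain ⟨e₀, x₀, hx₀, hmax⟩ := u.exists_max_norm_val
  have key : ∀ b, 0 < b → 2 * (b * Real.pi * ‖u.val e₀ x₀‖ ^ 4 / 8) ≤
      line.integral fun e x => ‖u.der e x‖ * solitonWeight b ‖u.val e₀ x₀‖ ‖u.val e x‖ := by
    intro b hb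
    set M := ‖u.val e₀ x₀‖ with hMdef
    have hnn : ∀ e x, 0 ≤ ‖u.der e x‖ * solitonWeight b M ‖u.val e x‖ := fun e x =>
      mul_nonneg (norm_nonneg _) (solitonWeight_nonneg hb.le _ (norm_nonneg _))
    rcases (norm_nonneg (u.val e₀ x₀)).eq_or_lt with h0 | hM
    · have h0' : 2 * (b * Real.pi * M ^ 4 / 8) = 0 := by rw [hMdef, ← h0]; simp
      rw [h0']
      exact line.integral_nonneg_of_nonneg hnn
    have hlen : ∀ e, line.len e = ⊤ := fun _ => rfl
    have hint := u.integrableOn_norm_der_mul_solitonWeight hb.le M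
    rw [← integral_solitonWeight b hM]
    set W : ℝ → ℝ := fun s => ∫ r in (0 : ℝ)..s, solitonWeight b M r with hW
    have h1 := fun e {x : ℝ} (hx : 0 ≤ x) => u.comp_norm_val_le_integral_Ioi (hlen e) (W := W)
      (continuous_solitonWeight b M) (fun s hs => solitonWeight_nonneg hb.le _ hs)
      (H1.primitive_solitonWeight_hasDerivAt b _) (by simp [hW]) (hint e) hx
    have hx₀' : 0 ≤ x₀ := nonneg_of_mem_interval hx₀
    have h2 := u.abs_comp_norm_val_sub_le (α := 0) (β := M) (W := W) e₀ hx₀'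
      (zero_mem_interval e₀) hx₀
      (fun t ht => ⟨norm_nonneg _, hmax e₀ t (Icc_subset_interval (zero_mem_interval e₀) hx₀ ht)⟩)
      (fun s _ => H1.primitive_solitonWeight_hasDerivAt b M s)
      (fun s hs => (abs_of_nonneg (solitonWeight_nonneg hb.le M hs.1)).le)
      (continuous_solitonWeight b M).continuousOn
    -- Three pieces add up to 2 W(M): the ray beyond x₀ gives W(M), the segment from 0 to x₀ gives
    -- W(M) - W(‖u(0)‖), and the other half-line gives W(‖u(0)‖).
    have h3 := h1 e₀ hx₀'
    have h4 := h1 (!e₀) le_rfl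
    have hval : u.val (!e₀) 0 = u.val e₀ 0 :=
      u.continuous_vertex none _ _ _ _ (Or.inl ⟨rfl, rfl⟩) (Or.inl ⟨rfl, rfl⟩)
    rw [hval] at h4
    have h5 := (abs_le.1 h2).2
    have h6 : (∫ t in (0 : ℝ)..x₀, ‖u.der e₀ t‖ * solitonWeight b M ‖u.val e₀ t‖) +
        ∫ t in Ioi x₀, ‖u.der e₀ t‖ * solitonWeight b M ‖u.val e₀ t‖ =
        ∫ t in Ioi 0, ‖u.der e₀ t‖ * solitonWeight b M ‖u.val e₀ t‖ := by
      have := hint e₀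
      rw [interval_eq_Ici (hlen e₀)] at this
      exact intervalIntegral.integral_interval_add_Ioi (this.mono_set Ioi_subset_Ici_self)
        (this.mono_set fun t ht => mem_Ici.2 (hx₀'.trans (mem_Ioi.1 ht).le))
    have h7 : (line.integral fun e x => ‖u.der e x‖ * solitonWeight b M ‖u.val e x‖) =
        (∫ t in Ioi 0, ‖u.der e₀ t‖ * solitonWeight b M ‖u.val e₀ t‖) +
        ∫ t in Ioi 0, ‖u.der (!e₀) t‖ * solitonWeight b M ‖u.val (!e₀) t‖ := by
      simp only [integral, interval_eq_Ici (hlen _), integral_Ici_eq_integral_Ioi,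
        Fintype.sum_bool]
      cases e₀ <;> simp [add_comm]
    rw [h7]
    have h8 : W ‖u.val e₀ x₀‖ = ∫ r in (0 : ℝ)..M, solitonWeight b M r := rfl
    linarith
  have := u.potential_le_of_mul_integral_le two_pos hmax key
  refine this.trans_eq ?_
  congr 2
  field_simp; norm_num

end MetricGraph

/-! ### The soliton, its integrals and its truncations. -/

/-- The critical soliton `sech^{1/2}`. -/
noncomputable def soliton (y : ℝ) : ℝ := (√(Real.cosh y))⁻¹

/-- The derivative of `soliton`. -/
noncomputable def solitonDeriv (y : ℝ) : ℝ := -(Real.sinh y / (2 * Real.cosh y)) * soliton y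

theorem soliton_pos (y : ℝ) : 0 < soliton y :=
  inv_pos.2 (Real.sqrt_pos.2 (Real.cosh_pos y))

theorem soliton_sq (y : ℝ) : soliton y ^ 2 = (Real.cosh y)⁻¹ := by
  rw [soliton, inv_pow, Real.sq_sqrt (Real.cosh_pos y).le]

theorem soliton_pow_six (y : ℝ) : soliton y ^ 6 = (Real.cosh y ^ 3)⁻¹ := by
  rw [show soliton y ^ 6 = (soliton y ^ 2) ^ 3 by ring, soliton_sq, inv_pow]

theorem solitonDeriv_sq (y : ℝ) :
    solitonDeriv y ^ 2 = 1 / 4 * ((Real.cosh y)⁻¹ - (Real.cosh y ^ 3)⁻¹) := by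
  have := (Real.cosh_pos y).ne'
  rw [solitonDeriv, mul_pow, soliton_sq, neg_sq, div_pow, Real.sinh_sq]
  field_simp; ring

theorem soliton_neg (y : ℝ) : soliton (-y) = soliton y := by simp [soliton]

theorem solitonDeriv_neg (y : ℝ) : solitonDeriv (-y) = -solitonDeriv y := by
  simp [solitonDeriv, soliton_neg, neg_div]

theorem soliton_le_one (y : ℝ) : soliton y ≤ 1 :=
  inv_le_one_of_one_le₀ (Real.one_le_sqrt.2 (Real.one_le_cosh y))

theorem soliton_le_soliton {x y : ℝ} : soliton x ≤ soliton y ↔ |y| ≤ |x| := by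
  rw [soliton, soliton, inv_le_inv₀ (Real.sqrt_pos.2 (Real.cosh_pos x))
    (Real.sqrt_pos.2 (Real.cosh_pos y)), Real.sqrt_le_sqrt_iff (Real.cosh_pos x).le,
    Real.cosh_le_cosh]

theorem hasDerivAt_soliton (y : ℝ) : HasDerivAt soliton (solitonDeriv y) y := by
  have hc := Real.cosh_pos y
  have hs := Real.sqrt_pos.2 hc
  refine (((Real.hasDerivAt_cosh y).sqrt hc.ne').inv hs.ne').congr_deriv ?_
  have := Real.sq_sqrt hc.le
  rw [solitonDeriv, soliton, this]
  field_simp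

theorem continuous_soliton : Continuous soliton :=
  continuous_iff_continuousAt.2 fun y => (hasDerivAt_soliton y).continuousAt

theorem continuous_solitonDeriv : Continuous solitonDeriv := by
  unfold solitonDeriv
  have h : ∀ y, 2 * Real.cosh y ≠ 0 := fun y => by have := Real.cosh_pos y; positivity
  have := continuous_soliton
  have h2 : Continuous fun y => Real.sinh y / (2 * Real.cosh y) :=
    Real.continuous_sinh.div (by fun_prop) h
  fun_prop

theorem tendsto_cosh_inv_atTop : Tendsto (fun y => (Real.cosh y)⁻¹) atTop (𝓝 0) :=
  tendsto_inv_atTop_zero.comp (tendsto_atTop_mono (fun y => (Real.sinh_lt_cosh y).le)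
    (tendsto_atTop_mono' atTop ((eventually_ge_atTop 0).mono fun _ hy => Real.self_le_sinh_iff.2 hy)
      tendsto_id))

theorem tendsto_soliton_atTop : Tendsto soliton atTop (𝓝 0) := by
  have h := (Real.continuous_sqrt.tendsto 0).comp tendsto_cosh_inv_atTop
  rw [Real.sqrt_zero] at h
  exact h.congr fun y => by simp [soliton, Real.sqrt_inv]

theorem hasDerivAt_arctan_sinh (y : ℝ) :
    HasDerivAt (fun y => Real.arctan (Real.sinh y)) (Real.cosh y)⁻¹ y := by
  refine (Real.hasDerivAt_sinh y).arctan.congr_deriv ?_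
  have := (Real.cosh_pos y).ne'
  rw [← Real.cosh_sq']
  field_simp

theorem tendsto_arctan_sinh_atTop :
    Tendsto (fun y => Real.arctan (Real.sinh y)) atTop (𝓝 (Real.pi / 2)) :=
  (Real.tendsto_arctan_atTop.mono_right nhdsWithin_le_nhds).comp
    (tendsto_atTop_mono' atTop ((eventually_ge_atTop 0).mono fun _ hy => Real.self_le_sinh_iff.2 hy)
      tendsto_id)

theorem hasDerivAt_primitive_soliton_pow_six (y : ℝ) :
    HasDerivAt (fun y => 1 / 2 * (Real.sinh y / Real.cosh y ^ 2 + Real.arctan (Real.sinh y)))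
      (Real.cosh y ^ 3)⁻¹ y := by
  have hc := (Real.cosh_pos y).ne'
  refine ((((Real.hasDerivAt_sinh y).div ((Real.hasDerivAt_cosh y).pow 2) (pow_ne_zero 2 hc)).add
    (hasDerivAt_arctan_sinh y)).const_mul (1 / 2)).congr_deriv ?_
  have := Real.cosh_sq y
  field_simp
  simp only [Nat.cast_ofNat, Nat.add_one_sub_one, pow_one, Pi.pow_apply]
  linear_combination 2 * Real.cosh y ^ 4 * this

theorem tendsto_primitive_soliton_pow_six :
    Tendsto (fun y => 1 / 2 * (Real.sinh y / Real.cosh y ^ 2 + Real.arctan (Real.sinh y))) atTop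
      (𝓝 (Real.pi / 4)) := by
  have h : Tendsto (fun y => Real.sinh y / Real.cosh y ^ 2) atTop (𝓝 0) := by
    refine squeeze_zero' ((eventually_ge_atTop 0).mono fun y hy =>
      div_nonneg (Real.sinh_nonneg_iff.2 hy) (by positivity)) (Eventually.of_forall fun y => ?_)
      tendsto_cosh_inv_atTop
    have hc := Real.cosh_pos y
    rw [div_le_iff₀ (by positivity)]
    refine (Real.sinh_lt_cosh y).le.trans_eq ?_
    field_simp
  have := (h.add tendsto_arctan_sinh_atTop).const_mul (1 / 2)
  convert this using 2
  ring

theorem integrableOn_soliton_sq : IntegrableOn (fun y => soliton y ^ 2) (Ioi 0) := by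
  simp only [soliton_sq]
  exact integrableOn_Ioi_deriv_of_nonneg' (fun y _ => hasDerivAt_arctan_sinh y)
    (fun y _ => inv_nonneg.2 (Real.cosh_pos y).le) tendsto_arctan_sinh_atTop

theorem integral_soliton_sq : ∫ y in Ioi 0, soliton y ^ 2 = Real.pi / 2 := by
  simp only [soliton_sq]
  rw [integral_Ioi_of_hasDerivAt_of_nonneg' (fun y _ => hasDerivAt_arctan_sinh y)
    (fun y _ => inv_nonneg.2 (Real.cosh_pos y).le) tendsto_arctan_sinh_atTop]
  simp

theorem integrableOn_soliton_pow_six : IntegrableOn (fun y => soliton y ^ 6) (Ioi 0) := by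
  simp only [soliton_pow_six]
  exact integrableOn_Ioi_deriv_of_nonneg' (fun y _ => hasDerivAt_primitive_soliton_pow_six y)
    (fun y _ => inv_nonneg.2 (pow_nonneg (Real.cosh_pos y).le 3)) tendsto_primitive_soliton_pow_six

theorem integral_soliton_pow_six : ∫ y in Ioi 0, soliton y ^ 6 = Real.pi / 4 := by
  simp only [soliton_pow_six]
  rw [integral_Ioi_of_hasDerivAt_of_nonneg' (fun y _ => hasDerivAt_primitive_soliton_pow_six y)
    (fun y _ => inv_nonneg.2 (pow_nonneg (Real.cosh_pos y).le 3)) tendsto_primitive_soliton_pow_six]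
  simp

/-- The first integral of the soliton equation: |φ'| equals `solitonWeight` with b = 1/2 and M = 1.
The half-line integrals π/2, π/16, π/4 of φ², φ'², φ⁶ then give equality with constant 16/π². -/
theorem solitonDeriv_sq_eq (y : ℝ) :
    solitonDeriv y ^ 2 = 1 / 4 * (soliton y ^ 2 - soliton y ^ 6) := by
  rw [solitonDeriv_sq, soliton_sq, soliton_pow_six]

theorem integrableOn_solitonDeriv_sq : IntegrableOn (fun y => solitonDeriv y ^ 2) (Ioi 0) := by
  simp only [solitonDeriv_sq_eq]
  exact (integrableOn_soliton_sq.sub integrableOn_soliton_pow_six).const_mul _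

theorem integral_solitonDeriv_sq : ∫ y in Ioi 0, solitonDeriv y ^ 2 = Real.pi / 16 := by
  simp only [solitonDeriv_sq_eq]
  rw [integral_const_mul, integral_sub integrableOn_soliton_sq integrableOn_soliton_pow_six,
    integral_soliton_sq, integral_soliton_pow_six]
  ring

/-- An even, compactly supported, absolutely continuous function on the line. -/
structure BumpProfile where
  toFun : ℝ → ℝ
  deriv : ℝ → ℝ
  radius : ℝ
  radius_pos : 0 < radius
  continuous_toFun : Continuous toFun
  measurable_deriv : Measurable deriv
  deriv_bounded : ∃ C, ∀ y, |deriv y| ≤ C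
  toFun_eq_zero : ∀ y, radius ≤ |y| → toFun y = 0
  deriv_eq_zero : ∀ y, radius ≤ |y| → deriv y = 0
  sub_eq_integral : ∀ x y, toFun y - toFun x = ∫ t in x..y, deriv t
  toFun_neg : ∀ y, toFun (-y) = toFun y
  deriv_neg : ∀ y, deriv (-y) = -deriv y

/-- The soliton cut off at height `soliton R`. -/
noncomputable def truncatedSoliton (R : ℝ) (hR : 0 < R) : BumpProfile where
  toFun y := max (soliton y - soliton R) 0
  deriv y := if |y| < R then solitonDeriv y else 0
  radius := R
  radius_pos := hR
  continuous_toFun := by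
    have := continuous_soliton
    fun_prop
  measurable_deriv := Measurable.ite (isOpen_lt continuous_abs continuous_const).measurableSet
    continuous_solitonDeriv.measurable measurable_const
  deriv_bounded := by
    refine ⟨1, fun y => ?_⟩
    split_ifs
    · refine (sq_le_one_iff_abs_le_one _).1 ?_
      rw [solitonDeriv_sq_eq]
      nlinarith [pow_nonneg (soliton_pos y).le 6, soliton_le_one y, soliton_pos y]
    · simp
  toFun_eq_zero y hy := by
    refine max_eq_right (sub_nonpos.2 (soliton_le_soliton.2 ?_))
    rwa [abs_of_pos hR]
  deriv_eq_zero y hy := if_neg hy.not_gt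
  sub_eq_integral x y := by
    -- The truncation has kinks at ±R, which form the exceptional set.
    refine (integral_eq_of_hasDerivAt_off_countable
      (fun y => max (soliton y - soliton R) 0) _ (s := {R, -R}) (by simp) ?_ ?_ ?_).symm
    · have := continuous_soliton
      exact Continuous.continuousOn (by fun_prop)
    · rintro z ⟨-, hz⟩
      have hzR : |z| ≠ R := fun h => hz (by
        rcases (abs_eq hR.le).1 h with h | h <;> simp [h])
      rcases hzR.lt_or_gt with h | h
      · rw [if_pos h]
        refine ((hasDerivAt_soliton z).sub_const (soliton R)).congr_of_eventuallyEq ?_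
        filter_upwards [(isOpen_lt continuous_abs continuous_const).mem_nhds h] with w hw
        refine max_eq_left (sub_nonneg.2 (soliton_le_soliton.2 ?_))
        rw [abs_of_pos hR]; exact le_of_lt (by simpa using hw)
      · rw [if_neg h.not_gt]
        refine (hasDerivAt_const z (0 : ℝ)).congr_of_eventuallyEq ?_
        filter_upwards [(isOpen_lt continuous_const continuous_abs).mem_nhds h] with w hw
        refine max_eq_right (sub_nonpos.2 (soliton_le_soliton.2 ?_))
        rw [abs_of_pos hR]; exact le_of_lt (by simpa using hw)
    · have h : (fun y => if |y| < R then solitonDeriv y else 0) =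
          indicator {y | |y| < R} solitonDeriv := by
        ext y; simp [indicator]
      rw [h, intervalIntegrable_iff]
      exact (intervalIntegrable_iff.1 (continuous_solitonDeriv.intervalIntegrable _ _)).indicator
        (isOpen_lt continuous_abs continuous_const).measurableSet
  toFun_neg y := by rw [soliton_neg]
  deriv_neg y := by
    rw [abs_neg, solitonDeriv_neg]
    split_ifs <;> simp

namespace BumpProfile

/-- The integral of the square over the half-line. -/
noncomputable def mass (P : BumpProfile) : ℝ := ∫ y in Ioi 0, P.toFun y ^ 2

/-- The integral of the square of the derivative over the half-line. -/
noncomputable def kinetic (P : BumpProfile) : ℝ := ∫ y in Ioi 0, P.deriv y ^ 2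

/-- The integral of the sixth power over the half-line. -/
noncomputable def potential (P : BumpProfile) : ℝ := ∫ y in Ioi 0, P.toFun y ^ 6

theorem mass_nonneg (P : BumpProfile) : 0 ≤ P.mass := integral_nonneg fun _ => by positivity

theorem kinetic_nonneg (P : BumpProfile) : 0 ≤ P.kinetic := integral_nonneg fun _ => by positivity

end BumpProfile

section truncatedSoliton

variable {R : ℝ} (hR : 0 < R)

theorem truncatedSoliton_nonneg (y : ℝ) : 0 ≤ (truncatedSoliton R hR).toFun y := le_max_right _ _

theorem truncatedSoliton_le (y : ℝ) : (truncatedSoliton R hR).toFun y ≤ soliton y :=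
  max_le (by linarith [soliton_pos R]) (soliton_pos y).le

theorem integrableOn_truncatedSoliton_pow_six :
    IntegrableOn (fun y => (truncatedSoliton R hR).toFun y ^ 6) (Ioi 0) := by
  refine integrableOn_soliton_pow_six.mono'
    ((truncatedSoliton R hR).continuous_toFun.pow 6).aestronglyMeasurable (ae_of_all _ fun y => ?_)
  rw [Real.norm_of_nonneg (pow_nonneg (truncatedSoliton_nonneg hR y) 6)]
  exact pow_le_pow_left₀ (truncatedSoliton_nonneg hR y) (truncatedSoliton_le hR y) 6

theorem integrableOn_truncatedSoliton_sq :
    IntegrableOn (fun y => (truncatedSoliton R hR).toFun y ^ 2) (Ioi 0) := by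
  refine integrableOn_soliton_sq.mono'
    ((truncatedSoliton R hR).continuous_toFun.pow 2).aestronglyMeasurable (ae_of_all _ fun y => ?_)
  rw [Real.norm_of_nonneg (pow_nonneg (truncatedSoliton_nonneg hR y) 2)]
  exact pow_le_pow_left₀ (truncatedSoliton_nonneg hR y) (truncatedSoliton_le hR y) 2

theorem truncatedSoliton_mass_le : (truncatedSoliton R hR).mass ≤ Real.pi / 2 := by
  rw [← integral_soliton_sq]
  exact setIntegral_mono (integrableOn_truncatedSoliton_sq hR) integrableOn_soliton_sq fun y =>
    pow_le_pow_left₀ (truncatedSoliton_nonneg hR y) (truncatedSoliton_le hR y) 2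

theorem truncatedSoliton_kinetic_le : (truncatedSoliton R hR).kinetic ≤ Real.pi / 16 := by
  rw [← integral_solitonDeriv_sq]
  have hle : ∀ y, (truncatedSoliton R hR).deriv y ^ 2 ≤ solitonDeriv y ^ 2 := fun y => by
    simp only [truncatedSoliton]
    split_ifs
    · exact le_rfl
    · simpa using sq_nonneg _
  refine setIntegral_mono (integrableOn_solitonDeriv_sq.mono'
    ((truncatedSoliton R hR).measurable_deriv.pow_const 2).aestronglyMeasurable
    (ae_of_all _ fun y => ?_)) integrableOn_solitonDeriv_sq hle
  rw [Real.norm_of_nonneg (sq_nonneg _)]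
  exact hle y

/-- Its use is to pass from positive potential to positive mass. -/
theorem truncatedSoliton_potential_le_mass :
    (truncatedSoliton R hR).potential ≤ (truncatedSoliton R hR).mass :=
  setIntegral_mono (integrableOn_truncatedSoliton_pow_six hR)
    (integrableOn_truncatedSoliton_sq hR) fun y =>
    pow_le_pow_of_le_one (truncatedSoliton_nonneg hR y)
      ((truncatedSoliton_le hR y).trans (soliton_le_one y)) (by norm_num)

/-- Bernoulli's inequality gives (φ - φ(R))⁶ ≥ φ⁶ - 6 φ(R) φ⁵ on [0, R], and φ⁵ ≤ φ² because φ ≤ 1.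
The error vanishes as R → ∞. -/
theorem le_truncatedSoliton_potential :
    (∫ y in (0 : ℝ)..R, soliton y ^ 6) - 6 * soliton R * (Real.pi / 2) ≤
      (truncatedSoliton R hR).potential := by
  have hc := continuous_soliton
  have h1 : ∫ y in (0 : ℝ)..R, soliton y ^ 2 ≤ Real.pi / 2 := by
    rw [← integral_soliton_sq, intervalIntegral.integral_of_le hR.le]
    exact setIntegral_mono_set integrableOn_soliton_sq (ae_of_all _ fun y => sq_nonneg _)
      Ioc_subset_Ioi_self.eventuallyLE
  have h2 : ∫ y in (0 : ℝ)..R, (soliton y ^ 6 - 6 * soliton R * soliton y ^ 2) ≤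
      ∫ y in (0 : ℝ)..R, (truncatedSoliton R hR).toFun y ^ 6 := by
    refine intervalIntegral.integral_mono_on hR.le
      (Continuous.intervalIntegrable (by fun_prop) _ _)
      (((truncatedSoliton R hR).continuous_toFun.pow 6).intervalIntegrable _ _) fun y hy => ?_
    have hs := soliton_pos y
    have hle : soliton R ≤ soliton y := soliton_le_soliton.2 (by
      rw [abs_of_nonneg hy.1, abs_of_pos hR]; exact hy.2)
    have hval : (truncatedSoliton R hR).toFun y = soliton y - soliton R :=
      max_eq_left (sub_nonneg.2 hle)
    have hdiv : soliton R / soliton y ≤ 1 := (div_le_one hs).2 hle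
    have hb := one_add_mul_le_pow (a := -(soliton R / soliton y)) (by linarith) 6
    have hmul := mul_le_mul_of_nonneg_left hb (pow_nonneg hs.le 6)
    have e1 : soliton y ^ 6 * (1 + -(soliton R / soliton y)) ^ 6 = (soliton y - soliton R) ^ 6 := by
      rw [← mul_pow]; congr 1; field_simp; ring
    have e2 : soliton y ^ 6 * (1 + (6 : ℕ) * -(soliton R / soliton y)) =
        soliton y ^ 6 - 6 * soliton R * soliton y ^ 5 := by
      field_simp; push_cast; ring
    have e3 : soliton y ^ 5 ≤ soliton y ^ 2 :=
      pow_le_pow_of_le_one hs.le (soliton_le_one y) (by norm_num)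
    rw [hval]
    nlinarith [soliton_pos R, mul_le_mul_of_nonneg_left e3 (soliton_pos R).le]
  have h3 : ∫ y in (0 : ℝ)..R, (truncatedSoliton R hR).toFun y ^ 6 ≤
      (truncatedSoliton R hR).potential := by
    rw [intervalIntegral.integral_of_le hR.le]
    exact setIntegral_mono_set (integrableOn_truncatedSoliton_pow_six hR)
      (ae_of_all _ fun y => pow_nonneg (truncatedSoliton_nonneg hR y) 6)
      Ioc_subset_Ioi_self.eventuallyLE
  rw [intervalIntegral.integral_sub (Continuous.intervalIntegrable (by fun_prop) _ _)
    (Continuous.intervalIntegrable (by fun_prop) _ _), intervalIntegral.integral_const_mul] at h2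
  nlinarith [soliton_pos R, mul_le_mul_of_nonneg_left h1 (soliton_pos R).le]

end truncatedSoliton

/-- Compactly supported functions on the half-line come arbitrarily close to the constant
`16 / π²` in the Gagliardo-Nirenberg inequality. -/
theorem exists_bumpProfile {κ : ℝ} (hκ0 : 0 ≤ κ) (hκ : κ < 16 / Real.pi ^ 2) :
    ∃ P : BumpProfile, 0 < P.mass ∧ κ * P.mass ^ 2 * P.kinetic < P.potential := by
  have hpi := Real.pi_pos
  -- The left side is the bound for the full soliton; the right side is the limit as R → ∞ of the
  -- lower bound for the truncated potential, so a large R suffices.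
  have hlt : κ * (Real.pi / 2) ^ 2 * (Real.pi / 16) < Real.pi / 4 - 6 * 0 * (Real.pi / 2) := by
    rw [lt_div_iff₀ (by positivity)] at hκ
    nlinarith [mul_lt_mul_of_pos_right hκ hpi]
  have hlim : Tendsto (fun R => (∫ y in (0 : ℝ)..R, soliton y ^ 6) -
      6 * soliton R * (Real.pi / 2)) atTop (𝓝 (Real.pi / 4 - 6 * 0 * (Real.pi / 2))) := by
    have h1 := intervalIntegral_tendsto_integral_Ioi 0 integrableOn_soliton_pow_six tendsto_id
    rw [integral_soliton_pow_six] at h1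
    exact h1.sub ((tendsto_soliton_atTop.const_mul 6).mul_const _)
  obtain ⟨R, hRlt, hR⟩ := ((hlim.eventually (lt_mem_nhds hlt)).and (eventually_gt_atTop 0)).exists
  have h := hRlt.trans_le (le_truncatedSoliton_potential hR)
  have hk := (truncatedSoliton R hR).kinetic_nonneg
  have hm := (truncatedSoliton R hR).mass_nonneg
  have hle : κ * (truncatedSoliton R hR).mass ^ 2 * (truncatedSoliton R hR).kinetic ≤
      κ * (Real.pi / 2) ^ 2 * (Real.pi / 16) := by
    have := truncatedSoliton_mass_le hR
    have := truncatedSoliton_kinetic_le hR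
    gcongr
  have hp : 0 < (truncatedSoliton R hR).potential := lt_of_le_of_lt (by positivity) h
  exact ⟨truncatedSoliton R hR, hp.trans_le (truncatedSoliton_potential_le_mass hR),
    hle.trans_lt h⟩

/-! ### Placing scaled bumps on an edge. -/

theorem memLp_two_of_bounded_of_eq_zero {f : ℝ → ℂ} (hf : Measurable f) {C a b : ℝ}
    (hC : ∀ x, ‖f x‖ ≤ C) (h0 : ∀ x, x ∉ Icc a b → f x = 0) : MemLp f 2 volume := by
  have h : f = indicator (Icc a b) f := by
    ext x
    by_cases hx : x ∈ Icc a b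
    · rw [indicator_of_mem hx]
    · rw [indicator_of_notMem hx, h0 x hx]
  rw [h, memLp_indicator_iff_restrict measurableSet_Icc]
  exact MemLp.of_bound hf.aestronglyMeasurable C (ae_of_all _ hC)

namespace MetricGraph

variable {V E : Type*} {G : MetricGraph V E}

/-- Continuity at a terminal point thus imposes no condition, and a bump may be cut there at its
peak. -/
theorem IsTerminal.eq_of_isAt [Finite E] {v : V} (hv : G.IsTerminal v) {e e' : E} {x x' : ℝ}
    (h : G.IsAt v e x) (h' : G.IsAt v e' x') : e = e' ∧ x = x' := by
  have hd := hv.2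
  unfold degree at hd
  have hs : {e | G.src e = v}.Finite := toFinite _
  have ht : {e | G.tgt e = v}.Finite := toFinite _
  have hmix : ∀ f f', G.src f = v → G.tgt f' = v → False := by
    intro f f' hf hf'
    have h1 := (ncard_pos hs).2 ⟨f, hf⟩
    have h2 := (ncard_pos ht).2 ⟨f', hf'⟩
    omega
  rcases h with ⟨rfl, h⟩ | ⟨-, rfl, h⟩ <;> rcases h' with ⟨rfl, h'⟩ | ⟨-, rfl, h'⟩
  · exact ⟨(ncard_le_one hs).1 (by omega) _ h _ h', rfl⟩
  · exact (hmix _ _ h h').elim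
  · exact (hmix _ _ h' h).elim
  · have : e = e' := (ncard_le_one ht).1 (by omega) _ h _ h'
    exact ⟨this, by rw [this]⟩

theorem IsTerminal.exists_incident {v : V} (hv : G.IsTerminal v) :
    ∃ e, G.src e = v ∨ G.tgt e = v := by
  by_contra! hc
  have hd := hv.2
  simp [degree, hc] at hd

/-- Even functions supported in `[-R, R]` can be transported by `x ↦ l x - d` to the edge `e` so
that their integrals become `n / l` times their integral over the half-line, and that they vanish
at the ends of the edge that are not terminal. -/
def IsPlacement (G : MetricGraph V E) (e : E) (R n l d : ℝ) : Prop :=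
  ∀ F : ℝ → ℝ, (∀ y, F (-y) = F y) → (∀ y, R ≤ |y| → F y = 0) →
    (∀ v x, G.IsAt v e x → F (l * x - d) = 0 ∨ G.IsTerminal v) ∧
      ∫ x in G.interval e, F (l * x - d) = n / l * ∫ y in Ioi 0, F y

theorem setIntegral_interval_comp_mul {e : E} {R l : ℝ} (hl : 0 < l)
    (hlen : G.len e ≠ ⊤ → R ≤ l * (G.len e).toReal) {F : ℝ → ℝ}
    (hF : ∀ y, R ≤ |y| → F y = 0) :
    ∫ x in G.interval e, F (l * x) = 1 / l * ∫ y in Ioi 0, F y := by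
  have h1 : ∫ x in G.interval e, F (l * x) = ∫ x in Ici 0, F (l * x) := by
    by_cases h : G.len e = ⊤
    · rw [interval_eq_Ici h]
    · rw [interval_eq_Icc h]
      refine (setIntegral_eq_of_subset_of_forall_sdiff_eq_zero measurableSet_Ici Icc_subset_Ici_self
        fun x hx => hF _ ?_).symm
      have hx0 : 0 ≤ x := hx.1
      have hx1 : (G.len e).toReal < x := by
        by_contra! hc
        exact hx.2 ⟨hx0, hc⟩
      rw [abs_of_nonneg (by positivity)]
      exact (hlen h).trans (mul_le_mul_of_nonneg_left hx1.le hl.le)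
  rw [h1, integral_Ici_eq_integral_Ioi, integral_comp_mul_left_Ioi _ _ hl]
  simp

/-- Concentration at a terminal point. -/
theorem IsTerminal.exists_isPlacement {v : V} (hv : G.IsTerminal v) {R : ℝ} (hR : 0 < R) :
    ∃ e, ∃ L, 0 < L ∧ ∀ l, L ≤ l → ∃ d, G.IsPlacement e R 1 l d := by
  obtain ⟨e, he⟩ := hv.exists_incident
  -- After scaling, half the bump has width R/l, which must not exceed the edge length.
  obtain ⟨L, hL, hlen⟩ : ∃ L, 0 < L ∧ ∀ l, L ≤ l → G.len e ≠ ⊤ → R ≤ l * (G.len e).toReal := by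
    by_cases h : G.len e = ⊤
    · exact ⟨1, one_pos, fun l _ h' => (h' h).elim⟩
    · have := toReal_len_pos h
      refine ⟨R / (G.len e).toReal, by positivity, fun l hl _ => ?_⟩
      rwa [div_le_iff₀ this] at hl
  refine ⟨e, L, hL, fun l hl => ?_⟩
  have hl0 : 0 < l := hL.trans_le hl
  rcases he with he | he
  · refine ⟨0, fun F _ hF => ⟨fun w x hx => ?_, ?_⟩⟩
    · rcases hx with ⟨-, hw⟩ | ⟨hfin, rfl, -⟩
      · exact Or.inr (by rwa [← hw, he])
      · refine Or.inl (hF _ ?_)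
        rw [sub_zero, abs_of_nonneg (by positivity)]
        exact hlen l hl hfin
    · simpa using setIntegral_interval_comp_mul hl0 (hlen l hl) hF
  -- With the terminal point at the far end of the edge, the bump is centred there and evenness
  -- reduces to the previous orientation.
  · have hfin : G.len e ≠ ⊤ := fun h => hv.1 (he ▸ (G.tgt_mem_infinity_iff e).2 h)
    refine ⟨l * (G.len e).toReal, fun F hneg hF => ⟨fun w x hx => ?_, ?_⟩⟩
    · rcases hx with ⟨rfl, -⟩ | ⟨-, -, hw⟩
      · refine Or.inl (hF _ ?_)
        rw [mul_zero, zero_sub, abs_neg, abs_of_nonneg (by positivity)]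
        exact hlen l hl hfin
      · exact Or.inr (by rwa [← hw, he])
    · rw [← setIntegral_interval_comp_mul hl0 (hlen l hl) hF, interval_eq_Icc hfin,
        integral_Icc_eq_integral_Ioc, integral_Icc_eq_integral_Ioc,
        ← intervalIntegral.integral_of_le ENNReal.toReal_nonneg,
        ← intervalIntegral.integral_of_le ENNReal.toReal_nonneg]
      have := intervalIntegral.integral_comp_sub_left (a := 0) (b := (G.len e).toReal)
        (fun x => F (l * x)) (G.len e).toReal
      rw [sub_self, sub_zero] at this
      rw [← this]
      refine intervalIntegral.integral_congr fun x _ => ?_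
      rw [← hneg]
      congr 1; ring

/-- Any scale can be realized inside a half-line. -/
theorem isPlacement_of_len_eq_top {e : E} (he : G.len e = ⊤) {R l : ℝ} (hl : 0 < l) :
    G.IsPlacement e R 2 l R := by
  -- The bump is centred at R/l, so its support starts at the origin and the whole of it fits,
  -- whence the factor 2.
  intro F hneg hF
  refine ⟨fun w x hx => Or.inl (hF _ ?_), ?_⟩
  · rcases hx with ⟨rfl, -⟩ | ⟨hfin, -⟩
    · simp [le_abs_self]
    · exact (hfin he).elim
  · have h1 : ∫ x in Ioi 0, F (l * x - R) = l⁻¹ * ∫ y in Ioi 0, F (y - R) := by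
      have := integral_comp_mul_left_Ioi (fun y => F (y - R)) 0 hl
      simpa using this
    have h2 : ∫ y in Ioi 0, F (y - R) = ∫ y, F (y - R) := by
      refine setIntegral_eq_integral_of_forall_compl_eq_zero fun y hy => hF _ ?_
      have : y ≤ 0 := by simpa using hy
      exact le_abs.2 (Or.inr (by linarith))
    have h3 : ∫ y, F y = 2 * ∫ y in Ioi 0, F y := by
      rw [← integral_comp_abs]
      refine integral_congr_ae (ae_of_all _ fun y => ?_)
      rcases abs_choice y with h | h <;> simp only [h, hneg]
    rw [interval_eq_Ici he, integral_Ici_eq_integral_Ioi, h1, h2, integral_sub_right_eq_self, h3]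
    ring

end MetricGraph

namespace BumpProfile

open MetricGraph

variable {V E : Type*} {G : MetricGraph V E} (P : BumpProfile)

theorem bounded : ∃ C, ∀ y, |P.toFun y| ≤ C := by
  obtain ⟨C, hC⟩ := (isCompact_Icc (a := -P.radius) (b := P.radius)).exists_bound_of_continuousOn
    P.continuous_toFun.continuousOn
  refine ⟨max C 0, fun y => ?_⟩
  by_cases h : P.radius ≤ |y|
  · simp [P.toFun_eq_zero y h]
  · exact (hC y (abs_le.1 (not_le.1 h).le)).trans (le_max_left _ _)

theorem memLp_comp {f : ℝ → ℝ} (hf : Measurable f) (hb : ∃ C, ∀ y, |f y| ≤ C)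
    (h0 : ∀ y, P.radius ≤ |y| → f y = 0) (c : ℝ) {l : ℝ} (hl : 0 < l) (d : ℝ) :
    MemLp (fun x => ((c * f (l * x - d) : ℝ) : ℂ)) 2 volume := by
  obtain ⟨C, hC⟩ := hb
  refine memLp_two_of_bounded_of_eq_zero (C := |c| * C) (a := (d - P.radius) / l)
    (b := (d + P.radius) / l) (by fun_prop) (fun x => ?_) fun x hx => ?_
  · rw [Complex.norm_real, norm_mul, Real.norm_eq_abs, Real.norm_eq_abs]
    exact mul_le_mul_of_nonneg_left (hC _) (abs_nonneg _)
  · rw [h0, mul_zero, Complex.ofReal_zero]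
    by_contra! hc
    obtain ⟨h1, h2⟩ := abs_lt.1 hc
    refine hx ⟨?_, ?_⟩
    · rw [div_le_iff₀ hl]; linarith
    · rw [le_div_iff₀ hl]; linarith

open Classical in
/-- The bump profile, scaled and placed on one edge of a metric graph. -/
noncomputable def toH1 [Finite E] (P : BumpProfile) {e : E} {n l d : ℝ} (hl : 0 < l)
    (h : G.IsPlacement e P.radius n l d) (c : ℝ) : G.H1 where
  val e' x := if e' = e then ((c * P.toFun (l * x - d) : ℝ) : ℂ) else 0
  der e' x := if e' = e then (((c * l) * P.deriv (l * x - d) : ℝ) : ℂ) else 0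
  memLp_val e' := by
    by_cases he : e' = e
    · simp only [he, if_true]
      exact (P.memLp_comp P.continuous_toFun.measurable P.bounded P.toFun_eq_zero c hl d).restrict _
    · simp [he]
  memLp_der e' := by
    by_cases he : e' = e
    · simp only [he, if_true]
      exact (P.memLp_comp P.measurable_deriv P.deriv_bounded P.deriv_eq_zero (c * l) hl d).restrict _
    · simp [he]
  val_sub_val e' x _ y _ := by
    by_cases he : e' = e
    · simp only [he, if_true]
      rw [intervalIntegral.integral_ofReal, intervalIntegral.integral_const_mul,
        intervalIntegral.integral_comp_mul_sub _ hl.ne', ← P.sub_eq_integral, ← Complex.ofReal_sub]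
      congr 1
      rw [smul_eq_mul]
      field_simp
    · simp [he]
  continuous_vertex v e₁ x₁ e₂ x₂ h₁ h₂ := by
    by_cases hv : G.IsTerminal v
    · obtain ⟨rfl, rfl⟩ := hv.eq_of_isAt h₁ h₂
      rfl
    · have h0 : ∀ e' x, G.IsAt v e' x →
          (if e' = e then ((c * P.toFun (l * x - d) : ℝ) : ℂ) else 0) = 0 := by
        intro e' x hx
        by_cases he : e' = e
        · subst he
          rw [((h P.toFun P.toFun_neg P.toFun_eq_zero).1 v x hx).resolve_right hv]
          simp
        · simp [he]
      rw [h0 e₁ x₁ h₁, h0 e₂ x₂ h₂]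

section

variable [Fintype E] {e : E} {n l d : ℝ} (hl : 0 < l) (h : G.IsPlacement e P.radius n l d) (c : ℝ)

/-- When c² is proportional to l, this mass stays fixed while the kinetic and potential terms both
scale like l²: the problem is mass-critical. -/
theorem mass_toH1 : (P.toH1 hl h c).mass = n * c ^ 2 / l * P.mass := by
  have h1 := (h (fun y => P.toFun y ^ 2) (fun y => by simp only [P.toFun_neg])
    (fun y hy => by simp [P.toFun_eq_zero y hy])).2
  unfold H1.mass MetricGraph.integral
  rw [Finset.sum_eq_single e (fun e' _ he => by simp [toH1, he]) (by simp)]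
  simp only [toH1, if_true, Complex.norm_real, Real.norm_eq_abs, sq_abs, mul_pow]
  rw [integral_const_mul, h1, BumpProfile.mass]
  ring

theorem kinetic_toH1 : (P.toH1 hl h c).kinetic = n * c ^ 2 * l * P.kinetic := by
  have h1 := (h (fun y => P.deriv y ^ 2) (fun y => by simp only [P.deriv_neg, neg_sq])
    (fun y hy => by simp [P.deriv_eq_zero y hy])).2
  unfold H1.kinetic MetricGraph.integral
  rw [Finset.sum_eq_single e (fun e' _ he => by simp [toH1, he]) (by simp)]
  simp only [toH1, if_true, Complex.norm_real, Real.norm_eq_abs, sq_abs, mul_pow]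
  rw [integral_const_mul, h1, BumpProfile.kinetic]
  field_simp

theorem potential_toH1 : (P.toH1 hl h c).potential = n * c ^ 6 / l * P.potential := by
  have h1 := (h (fun y => P.toFun y ^ 6) (fun y => by simp only [P.toFun_neg])
    (fun y hy => by simp [P.toFun_eq_zero y hy])).2
  unfold H1.potential MetricGraph.integral
  rw [Finset.sum_eq_single e (fun e' _ he => by simp [toH1, he]) (by simp)]
  simp only [toH1, if_true, Complex.norm_real, Real.norm_eq_abs, mul_pow,
    (show Even 6 by decide).pow_abs]
  rw [integral_const_mul, h1, BumpProfile.potential]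
  ring

end

end BumpProfile

/-! ### Critical masses and energy levels. -/

namespace MetricGraph

variable {V E : Type*} {G : MetricGraph V E}

theorem halfline_connected : halfline.Connected := by
  have : Nonempty (Option Unit) := ⟨none⟩
  refine { preconnected := ?_ }
  have h : ∀ v, (SimpleGraph.fromRel fun v w : Option Unit => ∃ e, halfline.src e = v ∧
      halfline.tgt e = w).Reachable none v := by
    rintro (_ | ⟨⟩)
    · rfl
    · refine SimpleGraph.Adj.reachable ?_
      rw [SimpleGraph.fromRel_adj]
      exact ⟨by simp, Or.inl ⟨(), rfl, rfl⟩⟩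
  exact fun v w => (h v).symm.trans (h w)

theorem halfline_isTerminal : halfline.IsTerminal none := by
  have h1 : {e | halfline.src e = none} = {()} := by ext; simp [halfline, starGraph]
  have h2 : {e | halfline.tgt e = none} = ∅ := by ext; simp [halfline, starGraph]
  refine ⟨by simp [halfline, starGraph], ?_⟩
  rw [degree, h1, h2]; simp

variable [Fintype E]

/-- With a terminal point, the best Gagliardo-Nirenberg constant is that of the half-line. -/
theorem gnConstant_eq (hconn : G.Connected) (hterm : ∃ v, G.IsTerminal v) :
    G.gnConstant = 16 / Real.pi ^ 2 := by
  have hmem : 16 / Real.pi ^ 2 ∈ {C : ℝ | 0 ≤ C ∧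
      ∀ u : G.H1, u.potential ≤ C * u.mass ^ 2 * u.kinetic} :=
    ⟨by positivity, fun u => u.potential_le hconn⟩
  refine le_antisymm (csInf_le ⟨0, fun C hC => hC.1⟩ hmem) (le_csInf ⟨_, hmem⟩ ?_)
  rintro C ⟨hC0, hC⟩
  by_contra! hlt
  obtain ⟨P, hm, hP⟩ := exists_bumpProfile hC0 hlt
  obtain ⟨v, hv⟩ := hterm
  obtain ⟨e, L, hL, h⟩ := hv.exists_isPlacement P.radius_pos
  obtain ⟨d, hd⟩ := h L le_rfl
  have h1 := hC (P.toH1 hL hd 1)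
  rw [P.mass_toH1, P.kinetic_toH1, P.potential_toH1] at h1
  -- The Gagliardo-Nirenberg quotient is invariant under scaling, so L drops out.
  have h2 : C * (1 * 1 ^ 2 / L * P.mass) ^ 2 * (1 * 1 ^ 2 * L * P.kinetic) =
      1 * 1 ^ 6 / L * (C * P.mass ^ 2 * P.kinetic) := by field_simp
  rw [h2] at h1
  exact absurd (le_of_mul_le_mul_left h1 (by positivity)) (not_le.2 hP)

theorem criticalMass_eq (hconn : G.Connected) (hterm : ∃ v, G.IsTerminal v) :
    G.criticalMass = √3 * Real.pi / 4 := by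
  have := Real.pi_pos
  rw [criticalMass, gnConstant_eq hconn hterm,
    show 3 / (16 / Real.pi ^ 2) = 3 * (Real.pi / 4) ^ 2 by field_simp; norm_num,
    Real.sqrt_mul (by norm_num), Real.sqrt_sq (by positivity)]
  ring

theorem line_gnConstant_pos : 0 < line.gnConstant := by
  have hpi := Real.pi_pos
  obtain ⟨P, hm, hP⟩ := exists_bumpProfile le_rfl (by positivity : (0 : ℝ) < 16 / Real.pi ^ 2)
  simp only [zero_mul] at hP
  have hd := isPlacement_of_len_eq_top (G := line) (e := true) rfl (R := P.radius) one_pos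
  set u := P.toH1 one_pos hd 1
  have hu : 0 < u.potential := by
    rw [P.potential_toH1]; linarith
  have hmk : 0 < u.mass ^ 2 * u.kinetic := by
    refine lt_of_le_of_ne (mul_nonneg (sq_nonneg _) u.kinetic_nonneg) fun h0 => ?_
    have := line_potential_le u
    rw [mul_assoc, ← h0] at this
    linarith
  have hle : u.potential / (u.mass ^ 2 * u.kinetic) ≤ line.gnConstant := by
    refine le_csInf ⟨_, by positivity, line_potential_le⟩ ?_
    rintro C ⟨-, hC⟩
    rw [div_le_iff₀ hmk, ← mul_assoc]
    exact hC u
  exact (div_pos hu hmk).trans_le hle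

/-- The constant 4/π² puts the critical mass of the line at √3π/2 or more; its sharpness is not
needed. -/
theorem lt_line_criticalMass : √3 * Real.pi / 4 < line.criticalMass := by
  have hpi := Real.pi_pos
  have hle : line.gnConstant ≤ 4 / Real.pi ^ 2 :=
    csInf_le ⟨0, fun C hC => hC.1⟩ ⟨by positivity, line_potential_le⟩
  have h0 := line_gnConstant_pos
  rw [criticalMass]
  refine Real.lt_sqrt_of_sq_lt ?_
  rw [lt_div_iff₀ h0, div_pow, mul_pow, Real.sq_sqrt (by norm_num)]
  calc 3 * Real.pi ^ 2 / 4 ^ 2 * line.gnConstant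
      ≤ 3 * Real.pi ^ 2 / 4 ^ 2 * (4 / Real.pi ^ 2) := by gcongr
    _ = 3 / 4 := by field_simp
    _ < 3 := by norm_num

theorem groundEnergy_le (u : G.H1) : G.groundEnergy u.mass ≤ u.energy :=
  iInf₂_le (f := fun (v : G.H1) (_ : v.mass = u.mass) => (v.energy : EReal)) u rfl

/-- The energy of a scaled and placed bump profile, normalized to have mass `μ`. -/
theorem exists_energy_eq (P : BumpProfile) (hm : 0 < P.mass) {e : E} {n l d μ : ℝ} (hn : 0 < n)
    (hl : 0 < l) (hμ : 0 < μ) (h : G.IsPlacement e P.radius n l d) :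
    ∃ u : G.H1, u.mass = μ ∧ u.energy = l ^ 2 * (μ / 2 * (P.kinetic / P.mass) -
      μ ^ 3 / (6 * n ^ 2) * (P.potential / P.mass ^ 3)) := by
  -- The amplitude c is fixed by (n c² / l) · `P.mass` = μ.
  have hc : √(μ * l / (n * P.mass)) ^ 2 = μ * l / (n * P.mass) := Real.sq_sqrt (by positivity)
  have hc6 : √(μ * l / (n * P.mass)) ^ 6 = (μ * l / (n * P.mass)) ^ 3 := by
    rw [show 6 = 2 * 3 by rfl, pow_mul, hc]
  refine ⟨P.toH1 hl h √(μ * l / (n * P.mass)), ?_, ?_⟩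
  · rw [P.mass_toH1, hc]; field_simp
  · rw [H1.energy, P.kinetic_toH1, P.potential_toH1, hc, hc6]; field_simp

/-- Above √3π/4 one has 3/μ² < 16/π², so some profile beats the constant 3/μ². Its normalized energy
is l² A with A < 0, and l → ∞ concentrates it at the terminal point. -/
theorem groundEnergy_eq_bot (hterm : ∃ v, G.IsTerminal v) {μ : ℝ} (hμ : √3 * Real.pi / 4 < μ) :
    G.groundEnergy μ = ⊥ := by
  have hpi := Real.pi_pos
  have h3 : (0 : ℝ) < √3 := Real.sqrt_pos.2 (by norm_num)
  have hμ0 : 0 < μ := lt_trans (by positivity) hμ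
  have hκ : 3 / μ ^ 2 < 16 / Real.pi ^ 2 := by
    have := pow_lt_pow_left₀ hμ (by positivity) two_ne_zero
    rw [div_pow, mul_pow, Real.sq_sqrt (by norm_num)] at this
    rw [div_lt_div_iff₀ (by positivity) (by positivity)]
    linarith
  obtain ⟨P, hm, hP⟩ := exists_bumpProfile (by positivity) hκ
  obtain ⟨v, hv⟩ := hterm
  obtain ⟨e, L, hL, h⟩ := hv.exists_isPlacement P.radius_pos
  set A := μ / 2 * (P.kinetic / P.mass) - μ ^ 3 / (6 * 1 ^ 2) * (P.potential / P.mass ^ 3) with hA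
  have hAneg : A < 0 := by
    have h1 : A = μ ^ 3 / (6 * P.mass ^ 3) * (3 / μ ^ 2 * P.mass ^ 2 * P.kinetic - P.potential) := by
      rw [hA]; field_simp; ring
    rw [h1]
    exact mul_neg_of_pos_of_neg (by positivity) (sub_neg.2 hP)
  refine EReal.eq_bot_iff_forall_lt _ |>.2 fun y => ?_
  obtain ⟨l, hlL, hl⟩ : ∃ l, L ≤ l ∧ l ^ 2 * A < y := by
    have : Tendsto (fun l : ℝ => l ^ 2 * A) atTop atBot :=
      (tendsto_pow_atTop two_ne_zero).atTop_mul_const_of_neg hAneg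
    obtain ⟨l, h1, h2⟩ := ((eventually_ge_atTop L).and (this.eventually (eventually_lt_atBot y))).exists
    exact ⟨l, h1, h2⟩
  obtain ⟨d, hd⟩ := h l hlL
  obtain ⟨u, hu, hE⟩ := exists_energy_eq P hm one_pos (hL.trans_le hlL) hμ0 hd
  rw [← hu]
  refine (groundEnergy_le u).trans_lt ?_
  rw [hE, ← hA]
  exact EReal.coe_lt_coe_iff.2 hl

/-- A bump flattened along a half-line has energy l² A, which tends to 0 as l → 0 whatever the sign
of A. -/
theorem groundEnergy_le_zero {μ : ℝ} (hμ : 0 < μ) : G.groundEnergy μ ≤ 0 := by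
  have hpi := Real.pi_pos
  obtain ⟨P, hm, -⟩ := exists_bumpProfile le_rfl (by positivity : (0 : ℝ) < 16 / Real.pi ^ 2)
  obtain ⟨e, he⟩ := exists_infinite_edge G
  set A := μ / 2 * (P.kinetic / P.mass) - μ ^ 3 / (6 * 2 ^ 2) * (P.potential / P.mass ^ 3) with hA
  have hlim : Tendsto (fun l : ℝ => ((l ^ 2 * A : ℝ) : EReal)) (𝓝[>] 0) (𝓝 ((0 ^ 2 * A : ℝ) : EReal)) :=
    (((continuous_coe_real_ereal).tendsto _).comp
      ((Continuous.tendsto (by fun_prop : Continuous fun l : ℝ => l ^ 2 * A) 0))).mono_left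
      nhdsWithin_le_nhds
  have hz : ((0 ^ 2 * A : ℝ) : EReal) = 0 := by simp
  rw [hz] at hlim
  refine ge_of_tendsto hlim (eventually_mem_nhdsWithin.mono fun l hl => ?_)
  obtain ⟨u, hu, hE⟩ := exists_energy_eq P hm two_pos hl hμ
    (isPlacement_of_len_eq_top he (R := P.radius) hl)
  rw [← hu, hA, ← hE]
  exact groundEnergy_le u

theorem H1.energy_nonneg (hconn : G.Connected) (u : G.H1) (hu : u.mass = √3 * Real.pi / 4) :
    0 ≤ u.energy := by
  have hpi := Real.pi_pos
  have h := u.potential_le hconn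
  rw [hu, div_pow, mul_pow, Real.sq_sqrt (by norm_num)] at h
  have h2 : 16 / Real.pi ^ 2 * (3 * Real.pi ^ 2 / 4 ^ 2) = 3 := by field_simp; norm_num
  rw [h2] at h
  rw [energy]; linarith

theorem groundEnergy_eq_zero (hconn : G.Connected) : G.groundEnergy (√3 * Real.pi / 4) = 0 := by
  have hpi := Real.pi_pos
  have h3 : (0 : ℝ) < √3 := Real.sqrt_pos.2 (by norm_num)
  refine le_antisymm (groundEnergy_le_zero (by positivity)) (le_iInf₂ fun u hu => ?_)
  exact_mod_cast u.energy_nonneg hconn hu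

end MetricGraph

/-! ### The half-line carries a minimizer. -/

/-- Distances to 0 leave a sign at each point. Opposite signs at x and y would give x + y = |x - y|,
which for nonnegative numbers forces one of them to be 0. -/
theorem eq_add_mul_of_abs_sub_eq {s : Set ℝ} (h0 : (0 : ℝ) ∈ s) (hs : ∀ x ∈ s, 0 ≤ x) {p : ℝ → ℝ}
    (hp : ∀ x ∈ s, ∀ y ∈ s, |p x - p y| = |x - y|) :
    ∃ a σ : ℝ, (σ = 1 ∨ σ = -1) ∧ ∀ x ∈ s, p x = a + σ * x := by
  have hsign : ∀ x ∈ s, p x = p 0 + x ∨ p x = p 0 - x := by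
    intro x hx
    have := hp x hx 0 h0
    rw [sub_zero] at this
    rcases abs_eq_abs.1 this with h | h
    · left; linarith
    · right; linarith
  by_cases hall : ∀ x ∈ s, p x = p 0 + x
  · exact ⟨p 0, 1, Or.inl rfl, fun x hx => by rw [one_mul]; exact hall x hx⟩
  · push Not at hall
    obtain ⟨y, hy, hne⟩ := hall
    have hy' := (hsign y hy).resolve_left hne
    refine ⟨p 0, -1, Or.inr rfl, fun x hx => ?_⟩
    rcases hsign x hx with h | h
    · have hd := hp x hx y hy
      rw [h, hy', show p 0 + x - (p 0 - y) = x + y by ring,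
        abs_of_nonneg (add_nonneg (hs x hx) (hs y hy))] at hd
      have hy0 : y ≠ 0 := by
        rintro rfl
        exact hne (by ring)
      have hypos := lt_of_le_of_ne (hs y hy) hy0.symm
      have hx0 : x = 0 := by
        rcases abs_cases (x - y) with h | h <;> linarith [hs x hx]
      rw [h, hx0]; ring
    · rw [h]; ring

theorem measurePreserving_add_mul {σ : ℝ} (hσ : σ = 1 ∨ σ = -1) (a : ℝ) :
    MeasurePreserving (fun x : ℝ => a + σ * x) volume volume := by
  rcases hσ with rfl | rfl
  · simpa using measurePreserving_add_left volume a
  · simpa [Function.comp_def] using (measurePreserving_add_left volume a).comp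
      (Measure.measurePreserving_neg (volume : Measure ℝ))

theorem measurableEmbedding_add_mul {σ : ℝ} (hσ : σ = 1 ∨ σ = -1) (a : ℝ) :
    MeasurableEmbedding (fun x : ℝ => a + σ * x) := by
  refine Continuous.measurableEmbedding (by fun_prop) fun x y h => ?_
  rcases hσ with rfl | rfl <;> simpa using h

namespace MetricGraph

variable {V E : Type*} {G : MetricGraph V E}

/-- An arclength parametrization of a metric graph by the half-line, affine on every edge. -/
structure HalflineChart (G : MetricGraph V E) where
  offset : E → ℝ
  sign : E → ℝ
  sign_eq : ∀ e, sign e = 1 ∨ sign e = -1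
  eq_iff_samePoint : ∀ e e', ∀ x ∈ G.interval e, ∀ x' ∈ G.interval e',
    offset e + sign e * x = offset e' + sign e' * x' ↔ G.SamePoint e x e' x'
  nonneg_iff : ∀ y, 0 ≤ y ↔ ∃ e, ∃ x ∈ G.interval e, offset e + sign e * x = y

theorem IsHalfline.nonempty_chart (h : G.IsHalfline) : Nonempty G.HalflineChart := by
  obtain ⟨p, hiso, hsame, hsurj⟩ := h
  choose a σ hσ hp using fun e => eq_add_mul_of_abs_sub_eq (zero_mem_interval e)
    (fun x hx => nonneg_of_mem_interval hx) (hiso e)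
  refine ⟨⟨a, σ, hσ, fun e e' x hx x' hx' => ?_, fun y => ?_⟩⟩
  · rw [← hp e x hx, ← hp e' x' hx']
    exact hsame e e' x hx x' hx'
  · rw [hsurj y]
    exact exists_congr fun e => exists_congr fun x => and_congr_right fun hx => by rw [hp e x hx]

namespace HalflineChart

variable (p : G.HalflineChart)

theorem image_subset (e : E) : (fun x => p.offset e + p.sign e * x) '' G.interval e ⊆ Ici 0 := by
  rintro _ ⟨x, hx, rfl⟩
  exact (p.nonneg_iff _).2 ⟨e, x, hx, rfl⟩

theorem iUnion_image : ⋃ e, (fun x => p.offset e + p.sign e * x) '' G.interval e = Ici 0 := by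
  refine (iUnion_subset p.image_subset).antisymm fun y hy => ?_
  obtain ⟨e, x, hx, h⟩ := (p.nonneg_iff y).1 hy
  exact mem_iUnion.2 ⟨e, x, hx, h⟩

theorem integrableOn_comp {f : ℝ → ℝ} (hf : IntegrableOn f (Ioi 0)) (e : E) :
    IntegrableOn (fun x => f (p.offset e + p.sign e * x)) (G.interval e) :=
  ((measurePreserving_add_mul (p.sign_eq e) (p.offset e)).integrableOn_image
    (measurableEmbedding_add_mul (p.sign_eq e) (p.offset e))).1
    (((integrableOn_Ici_iff_integrableOn_Ioi enorm_ne_top).2 hf).mono_set (p.image_subset e))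

theorem integral_comp [Fintype E] {f : ℝ → ℝ} (hf : IntegrableOn f (Ioi 0)) :
    G.integral (fun e x => f (p.offset e + p.sign e * x)) = ∫ y in Ioi 0, f y := by
  have h1 : ∀ e, ∫ x in G.interval e, f (p.offset e + p.sign e * x) =
      ∫ y in (fun x => p.offset e + p.sign e * x) '' G.interval e, f y := fun e =>
    ((measurePreserving_add_mul (p.sign_eq e) (p.offset e)).setIntegral_image_emb
      (measurableEmbedding_add_mul (p.sign_eq e) (p.offset e)) _ _).symm
  rw [MetricGraph.integral, Finset.sum_congr rfl fun e _ => h1 e, ← integral_Ici_eq_integral_Ioi,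
    ← p.iUnion_image, integral_iUnion_ae, tsum_fintype]
  · exact fun e => ((measurableEmbedding_add_mul (p.sign_eq e) (p.offset e)).measurableSet_image.2
      (measurableSet_interval e)).nullMeasurableSet
  -- Images of distinct edges meet only in images of endpoints, a null set.
  · intro e e' hne
    refine measure_mono_null (t := (fun x => p.offset e + p.sign e * x) ''
      {0, (G.len e).toReal}) ?_ (((toFinite _).image _).measure_zero _)
    rintro _ ⟨⟨x, hx, rfl⟩, x', hx', hxx'⟩
    refine mem_image_of_mem _ ?_
    rcases (p.eq_iff_samePoint e e' x hx x' hx').1 hxx'.symm with ⟨h, -⟩ | ⟨v, h, -⟩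
    · exact (hne h).elim
    · rcases h with ⟨h, -⟩ | ⟨-, h, -⟩ <;> simp [h]
  · rw [p.iUnion_image]
    exact (integrableOn_Ici_iff_integrableOn_Ioi enorm_ne_top).2 hf

theorem hasDerivAt_soliton_comp (c : ℝ) (e : E) (x : ℝ) :
    HasDerivAt (fun x => ((c * soliton (p.offset e + p.sign e * x) : ℝ) : ℂ))
      ((c * p.sign e * solitonDeriv (p.offset e + p.sign e * x) : ℝ) : ℂ) x := by
  refine HasDerivAt.ofReal_comp ?_
  have h := ((hasDerivAt_id x).const_mul (p.sign e)).const_add (p.offset e)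
  refine (((hasDerivAt_soliton _).comp x h).const_mul c).congr_deriv ?_
  simp only [mul_one, id]; ring

theorem memLp_of_integrable_sq {f : ℝ → ℝ} {s : Set ℝ} (hf : Continuous f)
    (h : IntegrableOn (fun x => f x ^ 2) s) : MemLp (fun x => ((f x : ℝ) : ℂ)) 2
      (volume.restrict s) :=
  ((memLp_two_iff_integrable_sq hf.aestronglyMeasurable).2 h).ofReal

/-- A multiple of the soliton, transported to the metric graph. -/
noncomputable def solitonH1 (c : ℝ) : G.H1 where
  val e x := ((c * soliton (p.offset e + p.sign e * x) : ℝ) : ℂ)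
  der e x := ((c * p.sign e * solitonDeriv (p.offset e + p.sign e * x) : ℝ) : ℂ)
  memLp_val e := by
    have := continuous_soliton
    refine memLp_of_integrable_sq (by fun_prop) ?_
    simp only [mul_pow]
    exact (p.integrableOn_comp integrableOn_soliton_sq e).const_mul _
  memLp_der e := by
    have := continuous_solitonDeriv
    refine memLp_of_integrable_sq (by fun_prop) ?_
    simp only [mul_pow]
    exact (p.integrableOn_comp integrableOn_solitonDeriv_sq e).const_mul _
  val_sub_val e x _ y _ := by
    refine (intervalIntegral.integral_eq_sub_of_hasDerivAt
      (fun z _ => p.hasDerivAt_soliton_comp c e z) ?_).symm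
    have := continuous_solitonDeriv
    exact Continuous.intervalIntegrable (by fun_prop) _ _
  continuous_vertex v e x e' x' h h' := by
    rw [(p.eq_iff_samePoint e e' x h.mem_interval x' h'.mem_interval).2 (Or.inr ⟨v, h, h'⟩)]

variable [Fintype E] (c : ℝ)

theorem mass_solitonH1 : (p.solitonH1 c).mass = c ^ 2 * (Real.pi / 2) := by
  rw [← integral_soliton_sq, ← integral_const_mul,
    ← p.integral_comp (integrableOn_soliton_sq.const_mul (c ^ 2))]
  simp only [H1.mass, solitonH1, Complex.norm_real, Real.norm_eq_abs, sq_abs, mul_pow]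

theorem kinetic_solitonH1 : (p.solitonH1 c).kinetic = c ^ 2 * (Real.pi / 16) := by
  have hs : ∀ e, p.sign e ^ 2 = 1 := fun e => by rcases p.sign_eq e with h | h <;> simp [h]
  rw [← integral_solitonDeriv_sq, ← integral_const_mul,
    ← p.integral_comp (integrableOn_solitonDeriv_sq.const_mul (c ^ 2))]
  simp only [H1.kinetic, solitonH1, Complex.norm_real, Real.norm_eq_abs, sq_abs, mul_pow, hs,
    mul_one]

theorem potential_solitonH1 : (p.solitonH1 c).potential = c ^ 6 * (Real.pi / 4) := by
  rw [← integral_soliton_pow_six, ← integral_const_mul,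
    ← p.integral_comp (integrableOn_soliton_pow_six.const_mul (c ^ 6))]
  simp only [H1.potential, solitonH1, Complex.norm_real, Real.norm_eq_abs,
    (show Even 6 by decide).pow_abs, mul_pow]

end HalflineChart

theorem IsHalfline.hasGroundState [Fintype E] (hconn : G.Connected) (h : G.IsHalfline) :
    G.HasGroundState (√3 * Real.pi / 4) := by
  obtain ⟨p⟩ := h.nonempty_chart
  -- The amplitude satisfies c² = √3/2, which makes the mass c² π/2 critical.
  have hc : √(√3 / 2) ^ 2 = √3 / 2 := Real.sq_sqrt (by positivity)
  have h3 : √(3 : ℝ) ^ 2 = 3 := Real.sq_sqrt (by norm_num)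
  refine ⟨p.solitonH1 √(√3 / 2), ?_, ?_⟩
  · rw [p.mass_solitonH1, hc]; ring
  · rw [groundEnergy_eq_zero hconn, H1.energy, p.kinetic_solitonH1, p.potential_solitonH1,
      show √(√3 / 2) ^ 6 = (√(√3 / 2) ^ 2) ^ 3 by ring, hc,
      show (√3 / 2 : ℝ) ^ 3 = √3 ^ 2 * √3 / 8 by ring, h3]
    norm_cast
    ring

end MetricGraph

/-! ### Measure-preserving contractions onto the half-line are isometries. -/

theorem volume_image_le_of_abs_sub_le {p : ℝ → ℝ} {s : Set ℝ}
    (hp : ∀ x ∈ s, ∀ y ∈ s, |p x - p y| ≤ |x - y|) : volume (p '' s) ≤ volume s := by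
  have h : LipschitzOnWith 1 p s := LipschitzOnWith.of_dist_le_mul fun x hx y hy => by
    simpa [Real.dist_eq] using hp x hx y hy
  have := h.hausdorffMeasure_image_le zero_le_one
  simpa [hausdorffMeasure_real] using this

/-- Comparable measures that give the same finite integral to a positive function are equal. -/
theorem eq_of_le_of_lintegral_eq {α : Type*} [MeasurableSpace α] {μ ν : Measure α}
    {f : α → ENNReal} (hf : Measurable f) (h0 : ∀ x, f x ≠ 0) (htop : ∀ x, f x ≠ ⊤) (hle : μ ≤ ν)
    (hfin : ∫⁻ x, f x ∂μ ≠ ⊤) (heq : ∫⁻ x, f x ∂μ = ∫⁻ x, f x ∂ν) : μ = ν := by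
  -- The measures may be infinite. Weighting by f makes them finite, so equal total mass suffices;
  -- the density is then divided out.
  have h1 : μ.withDensity f ≤ ν.withDensity f := Measure.le_iff.2 fun s hs => by
    rw [withDensity_apply _ hs, withDensity_apply _ hs]
    exact lintegral_mono' (Measure.restrict_mono le_rfl hle) le_rfl
  have : IsFiniteMeasure (μ.withDensity f) := isFiniteMeasure_withDensity hfin
  have h2 := Measure.eq_of_le_of_measure_univ_eq h1 (by simpa using heq)
  rw [← withDensity_inv_same (μ := μ) hf (ae_of_all _ h0) (ae_of_all _ htop), h2,
    withDensity_inv_same hf (ae_of_all _ h0) (ae_of_all _ htop)]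

namespace MetricGraph

variable {V E : Type*} {G : MetricGraph V E}

/-- A surjective map to `[0, ∞)`, contracting on every edge, that preserves the integral of one
positive function preserves the measure. -/
theorem sum_volume_preimage_eq [Fintype E] {p : E → ℝ → ℝ}
    (hlip : ∀ e, ∀ x ∈ G.interval e, ∀ y ∈ G.interval e, |p e x - p e y| ≤ |x - y|)
    (hsurj : ∀ y, 0 ≤ y ↔ ∃ e, ∃ x ∈ G.interval e, p e x = y)
    {F : ℝ → ℝ} (hFc : Continuous F) (hF0 : ∀ y, 0 < F y) (hFi : IntegrableOn F (Ioi 0))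
    (hFp : ∀ e, IntegrableOn (fun x => F (p e x)) (G.interval e))
    (hF : G.integral (fun e x => F (p e x)) = ∫ y in Ioi 0, F y) {A : Set ℝ}
    (hA : MeasurableSet A) :
    ∑ e, volume (p e ⁻¹' A ∩ G.interval e) = volume (A ∩ Ici 0) := by
  have hcont : ∀ e, ContinuousOn (p e) (G.interval e) := fun e =>
    (LipschitzOnWith.of_dist_le_mul (K := 1) fun x hx y hy => by
      simpa [Real.dist_eq] using hlip e x hx y hy).continuousOn
  have hmeas : ∀ e, AEMeasurable (p e) (volume.restrict (G.interval e)) := fun e =>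
    (hcont e).aemeasurable (measurableSet_interval e)
  set ν : Measure ℝ := ∑ e, (volume.restrict (G.interval e)).map (p e) with hν
  have hνA : ∀ A, MeasurableSet A → ν A = ∑ e, volume (p e ⁻¹' A ∩ G.interval e) := by
    intro A hA
    rw [hν, Measure.finsetSum_apply]
    refine Finset.sum_congr rfl fun e _ => ?_
    rw [Measure.map_apply_of_aemeasurable (hmeas e) hA,
      Measure.restrict_apply' (measurableSet_interval e)]
  -- The edges cover A by surjectivity, and contractions do not increase length.
  have hle : volume.restrict (Ici 0) ≤ ν := Measure.le_iff.2 fun A hA => by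
    rw [hνA A hA, Measure.restrict_apply hA]
    have hcover : A ∩ Ici 0 ⊆ ⋃ e, p e '' (p e ⁻¹' A ∩ G.interval e) := by
      rintro y ⟨hyA, hy⟩
      obtain ⟨e, x, hx, rfl⟩ := (hsurj y).1 hy
      exact mem_iUnion.2 ⟨e, x, ⟨hyA, hx⟩, rfl⟩
    refine ((measure_mono hcover).trans (measure_iUnion_le _)).trans ?_
    rw [tsum_fintype]
    exact Finset.sum_le_sum fun e _ => volume_image_le_of_abs_sub_le
      fun x hx y hy => hlip e x hx.2 y hy.2
  have hFm : Measurable fun y => ENNReal.ofReal (F y) := hFc.measurable.ennreal_ofReal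
  have h1 : ∫⁻ y, ENNReal.ofReal (F y) ∂(volume.restrict (Ici 0)) =
      ENNReal.ofReal (∫ y in Ioi 0, F y) := by
    rw [ofReal_integral_eq_lintegral_ofReal hFi (ae_of_all _ fun y => (hF0 y).le),
      Measure.restrict_congr_set Ioi_ae_eq_Ici]
  have h2 : ∫⁻ y, ENNReal.ofReal (F y) ∂ν = ENNReal.ofReal (∫ y in Ioi 0, F y) := by
    rw [← hF, hν, lintegral_finsetSum_measure, MetricGraph.integral,
      ENNReal.ofReal_sum_of_nonneg fun e _ => integral_nonneg fun x => (hF0 _).le]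
    refine Finset.sum_congr rfl fun e _ => ?_
    rw [lintegral_map' hFm.aemeasurable (hmeas e),
      ofReal_integral_eq_lintegral_ofReal (hFp e) (ae_of_all _ fun y => (hF0 _).le)]
  have heq := eq_of_le_of_lintegral_eq hFm (fun y => (ENNReal.ofReal_pos.2 (hF0 y)).ne')
    (fun y => ENNReal.ofReal_ne_top) hle (by rw [h1]; exact ENNReal.ofReal_ne_top) (h1.trans h2.symm)
  rw [← hνA A hA, ← heq, Measure.restrict_apply hA]

section

variable [Fintype E] {p : E → ℝ → ℝ}
    (hlip : ∀ e, ∀ x ∈ G.interval e, ∀ y ∈ G.interval e, |p e x - p e y| ≤ |x - y|)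
    (hmeas : ∀ A, MeasurableSet A →
      ∑ e, volume (p e ⁻¹' A ∩ G.interval e) = volume (A ∩ Ici 0))

include hlip hmeas

/-- The segment lies in the preimage of its own image interval, so it is no longer than that
interval. Contraction then forces the extrema to the endpoints, with equality. -/
theorem abs_sub_eq_of_sum_volume_preimage_eq (e : E) {x y : ℝ} (hx : x ∈ G.interval e)
    (hy : y ∈ G.interval e) : |p e x - p e y| = |x - y| := by
  wlog hxy : x ≤ y generalizing x y
  · rw [abs_sub_comm, abs_sub_comm x y]
    exact this hy hx (le_of_not_ge hxy)
  have hsub := Icc_subset_interval hx hy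
  have hcont : ContinuousOn (p e) (Icc x y) :=
    (LipschitzOnWith.of_dist_le_mul (K := 1) fun x hx y hy => by
      simpa [Real.dist_eq] using hlip e x hx y hy).continuousOn.mono hsub
  obtain ⟨z₁, hz₁, hmin⟩ := isCompact_Icc.exists_isMinOn (nonempty_Icc.2 hxy) hcont
  obtain ⟨z₂, hz₂, hmax⟩ := isCompact_Icc.exists_isMaxOn (nonempty_Icc.2 hxy) hcont
  have h1 : volume (Icc x y) ≤ volume (Icc (p e z₁) (p e z₂)) := by
    calc volume (Icc x y) ≤ volume (p e ⁻¹' Icc (p e z₁) (p e z₂) ∩ G.interval e) :=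
          measure_mono fun z hz => ⟨⟨hmin hz, hmax hz⟩, hsub hz⟩
      _ ≤ ∑ f, volume (p f ⁻¹' Icc (p e z₁) (p e z₂) ∩ G.interval f) :=
          Finset.single_le_sum (f := fun e' => volume (p e' ⁻¹' Icc (p e z₁) (p e z₂) ∩
            G.interval e')) (fun _ _ => zero_le) (Finset.mem_univ e)
      _ ≤ _ := by
          rw [hmeas _ measurableSet_Icc]
          exact measure_mono inter_subset_left
  rw [Real.volume_Icc, Real.volume_Icc] at h1
  have hz12 : p e z₁ ≤ p e z₂ := hmin hz₂
  rw [ENNReal.ofReal_le_ofReal_iff (sub_nonneg.2 hz12)] at h1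
  have h2 := hlip e z₁ (hsub hz₁) z₂ (hsub hz₂)
  have h3 := neg_abs_le (p e z₁ - p e z₂)
  rw [abs_of_nonpos (sub_nonpos.2 hxy)]
  refine le_antisymm ?_ ?_
  · have := hlip e x hx y hy
    rwa [abs_of_nonpos (sub_nonpos.2 hxy)] at this
  · rcases le_total z₁ z₂ with h | h
    · rw [abs_of_nonpos (sub_nonpos.2 h)] at h2
      have e1 : z₁ = x := by linarith [hz₁.1, hz₂.2]
      have e2 : z₂ = y := by linarith [hz₁.1, hz₂.2]
      rw [← e1, ← e2]
      rw [← e1, ← e2] at h1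
      linarith [neg_abs_le (p e z₁ - p e z₂)]
    · rw [abs_of_nonneg (sub_nonneg.2 h)] at h2
      have e1 : z₂ = x := by linarith [hz₂.1, hz₁.2]
      have e2 : z₁ = y := by linarith [hz₂.1, hz₁.2]
      rw [← e1, ← e2]
      rw [← e1, ← e2] at h1
      linarith [le_abs_self (p e z₂ - p e z₁)]

/-- Two distinct edges crossing [s, t] would each put length at least t - s into a preimage of total
length t - s. -/
theorem eq_of_lt_of_image {e e' : E} {x₁ x₂ x₁' x₂' : ℝ} (hx₁ : x₁ ∈ G.interval e)
    (hx₂ : x₂ ∈ G.interval e) (hx₁' : x₁' ∈ G.interval e') (hx₂' : x₂' ∈ G.interval e') {s t : ℝ}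
    (hs0 : 0 ≤ s) (hst : s < t) (h₁ : p e x₁ ≤ s) (h₂ : t ≤ p e x₂) (h₁' : p e' x₁' ≤ s)
    (h₂' : t ≤ p e' x₂') : e = e' := by
  classical
  by_contra hne
  have key : ∀ (f : E) (a b : ℝ), a ∈ G.interval f → b ∈ G.interval f → p f a ≤ s → t ≤ p f b →
      ENNReal.ofReal (t - s) ≤ volume (p f ⁻¹' Icc s t ∩ G.interval f) := by
    intro f a b ha hb hpa hpb
    have hcont : ContinuousOn (p f) (G.interval f) :=
      (LipschitzOnWith.of_dist_le_mul (K := 1) fun x hx y hy => by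
        simpa [Real.dist_eq] using hlip f x hx y hy).continuousOn
    rw [← Real.volume_Icc]
    refine (measure_mono (t := p f '' (p f ⁻¹' Icc s t ∩ G.interval f)) fun z hz => ?_).trans
      (volume_image_le_of_abs_sub_le fun x hx y hy => hlip f x hx.2 y hy.2)
    obtain ⟨w, hw, rfl⟩ := (ordConnected_interval f).isPreconnected.intermediate_value ha hb hcont
      ⟨hpa.trans hz.1, hz.2.trans hpb⟩
    exact ⟨w, ⟨hz, hw⟩, rfl⟩
  have h1 := key e x₁ x₂ hx₁ hx₂ h₁ h₂
  have h2 := key e' x₁' x₂' hx₁' hx₂' h₁' h₂'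
  have h3 : ∑ f ∈ {e, e'}, volume (p f ⁻¹' Icc s t ∩ G.interval f) ≤
      ∑ f, volume (p f ⁻¹' Icc s t ∩ G.interval f) :=
    Finset.sum_le_sum_of_subset (Finset.subset_univ _)
  rw [Finset.sum_pair hne, hmeas _ measurableSet_Icc,
    inter_eq_left.2 (fun z hz => mem_Ici.2 (hs0.trans hz.1)), Real.volume_Icc] at h3
  have h4 := (add_le_add h1 h2).trans h3
  rw [← ENNReal.ofReal_add (by linarith) (by linarith),
    ENNReal.ofReal_le_ofReal_iff (by linarith)] at h4
  linarith

/-- A measure preserving parametrization by the half-line that contracts every edge is an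
isometry. -/
theorem isHalfline_of_sum_volume_preimage_eq (hconn : G.Connected)
    (hsurj : ∀ y, 0 ≤ y ↔ ∃ e, ∃ x ∈ G.interval e, p e x = y)
    (hvert : ∀ v e x e' x', G.IsAt v e x → G.IsAt v e' x' → p e x = p e' x') :
    G.IsHalfline := by
  have hiso := fun e x hx y hy =>
    abs_sub_eq_of_sum_volume_preimage_eq hlip hmeas e (x := x) (y := y) hx hy
  have hinj : ∀ e, ∀ x ∈ G.interval e, ∀ y ∈ G.interval e, p e x = p e y → x = y := by
    intro e x hx y hy h
    have := hiso e x hx y hy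
    rw [h, sub_self, abs_zero] at this
    linarith [abs_eq_zero.1 this.symm]
  have hpos : ∀ {e x}, x ∈ G.interval e → 0 ≤ p e x := fun {e x} hx => (hsurj _).2 ⟨e, x, hx, rfl⟩
  have hother : ∀ e, ∀ x ∈ G.interval e, ∃ z ∈ G.interval e, p e z ≠ p e x := by
    intro e x hx
    obtain ⟨d, hd, hdm⟩ := exists_pos_mem_interval (G := G) e
    by_cases h : x = 0
    · exact ⟨d, hdm, fun h' => hd.ne' ((hinj e d hdm x hx h').trans h)⟩
    · exact ⟨0, zero_mem_interval e, fun h' => h (hinj e 0 (zero_mem_interval e) x hx h').symm⟩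
  have hup : ∀ {e e' x x' q z : _}, x ∈ G.interval e → x' ∈ G.interval e' → p e x = p e' x' →
      q ∈ G.interval e → z ∈ G.interval e' → p e x < p e q → p e x < p e' z → e = e' := by
    intro e e' x x' q z hx hx' h hq hz h1 h2
    exact eq_of_lt_of_image hlip hmeas hx hq hx' hz (hpos hx) (lt_min h1 h2) le_rfl
      (min_le_left _ _) h.ge (min_le_right _ _)
  have hdown : ∀ {e e' x x' q z : _}, x ∈ G.interval e → x' ∈ G.interval e' → p e x = p e' x' →
      q ∈ G.interval e → z ∈ G.interval e' → p e q < p e x → p e' z < p e x → e = e' := by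
    intro e e' x x' q z hx hx' h hq hz h1 h2
    exact eq_of_lt_of_image hlip hmeas hq hx hz hx' (le_max_of_le_left (hpos hq)) (max_lt h1 h2)
      (le_max_left _ _) le_rfl (le_max_right _ _) h.le
  -- The remaining configuration: e lies above the common level and e' below it. Staying above the
  -- level would pass through every vertex, hence reach e', unless some vertex joins an edge above
  -- to one going below. The uniqueness facts `hdown` and `hup` identify these two edges as e' and
  -- e, so that vertex is the common point.
  have hside : ∀ e e' x x', e ≠ e' → x ∈ G.interval e → x' ∈ G.interval e' → p e x = p e' x' →
      (∀ q ∈ G.interval e, p e x ≤ p e q) → (∀ z ∈ G.interval e', p e' z ≤ p e x) →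
      G.SamePoint e x e' x' := by
    intro e e' x x' hne hx hx' h hA hA'
    by_contra hnot
    obtain ⟨q, hq, hqne⟩ := hother e x hx
    have hqlt : p e x < p e q := lt_of_le_of_ne (hA q hq) hqne.symm
    obtain ⟨z, hz, hzne⟩ := hother e' x' hx'
    have hzlt : p e' z < p e x := lt_of_le_of_ne (hA' z hz) (h ▸ hzne)
    refine absurd (hconn.forall_edge (A := fun f => ∀ q ∈ G.interval f, p e x ≤ p f q) ?_ hA e' z hz)
      (not_le.2 hzlt)
    intro w f y f' y' hy hy' hf
    by_contra! hf'
    obtain ⟨z', hz', hz'lt⟩ := hf'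
    have hyy := hvert w f y f' y' hy hy'
    have hy0 := hf y hy.mem_interval
    obtain ⟨r, hr, hpr⟩ := (ordConnected_interval f').isPreconnected.intermediate_value hz'
      hy'.mem_interval ((LipschitzOnWith.of_dist_le_mul (K := 1) fun x hx y hy => by
        simpa [Real.dist_eq] using hlip f' x hx y hy).continuousOn) ⟨hz'lt.le, hyy ▸ hy0⟩
    have e1 : e' = f' := hdown hx' hr (h.symm.trans hpr.symm) hz hz' (h ▸ hzlt) (h ▸ hz'lt)
    subst e1
    have hye : p f y = p e x := le_antisymm (hyy ▸ hA' y' hy'.mem_interval) hy0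
    obtain ⟨q', hq', hq'ne⟩ := hother f y hy.mem_interval
    have e2 : e = f := hup hx hy.mem_interval hye.symm hq hq' hqlt
      (lt_of_le_of_ne (hf q' hq') (hye ▸ hq'ne).symm)
    subst e2
    obtain rfl := hinj _ _ hy.mem_interval _ hx hye
    obtain rfl := hinj _ _ hy'.mem_interval _ hx' (hyy.symm.trans h)
    exact hnot (Or.inr ⟨w, hy, hy'⟩)
  have hsame_symm : ∀ e x e' x', G.SamePoint e x e' x' → G.SamePoint e' x' e x := by
    rintro e x e' x' (⟨rfl, rfl⟩ | ⟨v, h, h'⟩)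
    · exact Or.inl ⟨rfl, rfl⟩
    · exact Or.inr ⟨v, h', h⟩
  refine ⟨p, hiso, fun e e' x hx x' hx' => ⟨fun h => ?_, ?_⟩, hsurj⟩
  · by_cases hne : e = e'
    · subst hne
      exact Or.inl ⟨rfl, hinj e x hx x' hx' h⟩
    · obtain ⟨q, hq, hqne⟩ := hother e x hx
      rcases hqne.lt_or_gt with hlt | hlt
      · refine hsame_symm _ _ _ _ (hside e' e x' x (Ne.symm hne) hx' hx h.symm (fun z hz => ?_)
          fun z hz => ?_)
        · by_contra! hc
          exact hne (hdown hx hx' h hq hz hlt (h ▸ hc))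
        · by_contra! hc
          obtain ⟨r, hr, hrne⟩ := hother e' x' hx'
          rcases hrne.lt_or_gt with hr' | hr'
          · exact hne (hdown hx hx' h hq hr hlt (h ▸ hr'))
          · exact hne (hup hx hx' h hz hr (h ▸ hc) (h ▸ hr'))
      · refine hside e e' x x' hne hx hx' h (fun z hz => ?_) fun z hz => ?_
        · by_contra! hc
          obtain ⟨r, hr, hrne⟩ := hother e' x' hx'
          rcases hrne.lt_or_gt with hr' | hr'
          · exact hne (hdown hx hx' h hz hr hc (h ▸ hr'))
          · exact hne (hup hx hx' h hq hr hlt (h ▸ hr'))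
        · by_contra! hc
          exact hne (hup hx hx' h hq hz hlt hc)
  · rintro (⟨rfl, rfl⟩ | ⟨v, h, h'⟩)
    · rfl
    · exact hvert v e x e' x' h h'

end

end MetricGraph

/-! ### Minimizers force the graph to be a half-line. -/

/-- The position at which the soliton of height `M` and frequency `k` takes the value `s`. -/
noncomputable def solitonPosition (k M s : ℝ) : ℝ := Real.arcosh (M ^ 2 / s ^ 2) / k

theorem solitonPosition_nonneg {k M s : ℝ} (hk : 0 < k) (hs : 0 < s) (hsM : s ≤ M) :
    0 ≤ solitonPosition k M s :=
  div_nonneg (Real.arcosh_nonneg ((one_le_div (by positivity)).2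
    (pow_le_pow_left₀ hs.le hsM 2))) hk.le

theorem sq_mul_soliton_solitonPosition {k M s : ℝ} (hk : 0 < k) (hs : 0 < s) (hsM : s ≤ M) :
    M ^ 2 * soliton (k * solitonPosition k M s) ^ 2 = s ^ 2 := by
  have hM := hs.trans_le hsM
  rw [solitonPosition, mul_div_cancel₀ _ hk.ne', soliton_sq, Real.cosh_arcosh
    ((one_le_div (by positivity)).2 (pow_le_pow_left₀ hs.le hsM 2))]
  field_simp

theorem solitonPosition_mul_soliton {k M y : ℝ} (hk : 0 < k) (hM : 0 < M) (hy : 0 ≤ y) :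
    solitonPosition k M (M * soliton (k * y)) = y := by
  have hc := Real.cosh_pos (k * y)
  rw [solitonPosition, mul_pow, soliton_sq,
    show M ^ 2 / (M ^ 2 * (Real.cosh (k * y))⁻¹) = Real.cosh (k * y) by field_simp,
    Real.arcosh_cosh (by positivity)]
  field_simp

theorem hasDerivAt_arcosh_div_sq {k A s : ℝ} (hs : 0 < s) (hA : s ^ 2 < A) :
    HasDerivAt (fun s => Real.arcosh (A / s ^ 2) / k)
      (-((√((A / s ^ 2) ^ 2 - 1))⁻¹ * (2 * A / s ^ 3) / k)) s := by
  have h1 : 1 < A / s ^ 2 := (one_lt_div (by positivity)).2 hA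
  have h2 := ((hasDerivAt_pow 2 s).fun_inv (pow_ne_zero 2 hs.ne')).const_mul A
  have h3 := ((Real.hasDerivAt_arcosh (x := A * (s ^ 2)⁻¹) (by
    rw [← div_eq_mul_inv]; exact h1)).comp s h2).div_const k
  simp only [← div_eq_mul_inv] at h3
  refine h3.congr_deriv ?_
  simp only [div_eq_mul_inv]
  field_simp
  ring

/-- The product equals A √(M⁴ - s⁴) / (M² √(A² - s⁴)), which increases to 1 as A decreases to M²
when s < M. Taking A > M² keeps the arcosh differentiable at s = M. -/
theorem solitonWeight_mul_le {b M A s : ℝ} (hb : 0 < b) (hM : 0 < M) (hs : 0 < s) (hsM : s ≤ M)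
    (hA : M ^ 2 < A) :
    solitonWeight b M s * ((√((A / s ^ 2) ^ 2 - 1))⁻¹ * (2 * A / s ^ 3) / (2 * b * M ^ 2)) ≤ 1 := by
  have hs2 : s ^ 2 ≤ M ^ 2 := pow_le_pow_left₀ hs.le hsM 2
  have hA0 : 0 < A := lt_trans (by positivity) hA
  have hpos : 0 < A ^ 2 - s ^ 4 := by nlinarith [sq_nonneg s]
  have e1 : √((A / s ^ 2) ^ 2 - 1) = √(A ^ 2 - s ^ 4) / s ^ 2 := by
    rw [show (A / s ^ 2) ^ 2 - 1 = (A ^ 2 - s ^ 4) / (s ^ 2) ^ 2 by field_simp,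
      Real.sqrt_div hpos.le, Real.sqrt_sq (by positivity)]
  have hr := Real.sqrt_pos.2 hpos
  have e2 : solitonWeight b M s * ((√((A / s ^ 2) ^ 2 - 1))⁻¹ * (2 * A / s ^ 3) /
      (2 * b * M ^ 2)) = A * √(M ^ 4 - s ^ 4) / (M ^ 2 * √(A ^ 2 - s ^ 4)) := by
    rw [e1, solitonWeight]; field_simp
  rw [e2, div_le_one (by positivity)]
  refine le_of_sq_le_sq ?_ (by positivity)
  have h4 : 0 ≤ M ^ 4 - s ^ 4 := by nlinarith [sq_nonneg s]
  rw [mul_pow, mul_pow, Real.sq_sqrt h4, Real.sq_sqrt hpos.le]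
  have h5 : M ^ 4 ≤ A ^ 2 := by nlinarith [sq_nonneg M]
  nlinarith [pow_pos hs 4]

namespace MetricGraph

variable {V E : Type*} {G : MetricGraph V E}

namespace H1

variable {u : G.H1} {b M : ℝ}

/-- Under the soliton equation the variation bound becomes a Lipschitz bound, the integrand being at
most C. -/
theorem abs_comp_norm_val_sub_le_mul {e : E}
    (hae : ∀ᵐ t ∂volume.restrict (G.interval e), ‖u.der e t‖ = solitonWeight b M ‖u.val e t‖)
    {α β C : ℝ} {W W' w : ℝ → ℝ} {x y : ℝ} (hxy : x ≤ y) (hx : x ∈ G.interval e)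
    (hy : y ∈ G.interval e) (hmem : ∀ t ∈ Icc x y, ‖u.val e t‖ ∈ Icc α β)
    (hW : ∀ s ∈ Icc α β, HasDerivAt W (W' s) s) (hle : ∀ s ∈ Icc α β, |W' s| ≤ w s)
    (hw : ContinuousOn w (Icc α β)) (hC : ∀ s ∈ Icc α β, solitonWeight b M s * w s ≤ C) :
    |W ‖u.val e y‖ - W ‖u.val e x‖| ≤ C * (y - x) := by
  have hsub := Icc_subset_interval hx hy
  have hcn : ContinuousOn (fun t => ‖u.val e t‖) (Icc x y) := ((u.continuousOn_val e).mono hsub).norm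
  have hcw : ContinuousOn (fun t => solitonWeight b M ‖u.val e t‖ * w ‖u.val e t‖) (Icc x y) :=
    ((continuous_solitonWeight b M).comp_continuousOn hcn).mul (hw.comp hcn hmem)
  have h1 : ∫ t in x..y, ‖u.der e t‖ * w ‖u.val e t‖ =
      ∫ t in x..y, solitonWeight b M ‖u.val e t‖ * w ‖u.val e t‖ := by
    rw [intervalIntegral.integral_of_le hxy, intervalIntegral.integral_of_le hxy]
    refine integral_congr_ae ?_
    filter_upwards [ae_restrict_of_ae_restrict_of_subset (Ioc_subset_Icc_self.trans hsub) hae]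
      with t ht
    rw [ht]
  refine (u.abs_comp_norm_val_sub_le e hxy hx hy hmem hW hle hw).trans ?_
  rw [h1]
  refine (intervalIntegral.integral_mono_on hxy (hcw.intervalIntegrable_of_Icc hxy)
    intervalIntegrable_const fun t ht => hC _ (hmem t ht)).trans_eq ?_
  rw [intervalIntegral.integral_const, smul_eq_mul, mul_comm]

/-- A Gronwall argument: the weight is at most bM²s, so log(‖u‖ + ε) is Lipschitz with constant bM²
for every ε; then ε → 0. -/
theorem val_eq_zero_of_val_eq_zero {e : E}
    (hae : ∀ᵐ t ∂volume.restrict (G.interval e), ‖u.der e t‖ = solitonWeight b M ‖u.val e t‖)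
    (hb : 0 ≤ b) (hM : ∀ x ∈ G.interval e, ‖u.val e x‖ ≤ M) {x y : ℝ} (hx : x ∈ G.interval e)
    (hy : y ∈ G.interval e) (h0 : u.val e x = 0) : u.val e y = 0 := by
  have key : ∀ ε > 0, Real.log (‖u.val e y‖ + ε) - Real.log ε ≤ b * M ^ 2 * |y - x| := by
    intro ε hε
    have haux : ∀ {x y : ℝ}, x ≤ y → x ∈ G.interval e → y ∈ G.interval e →
        |Real.log (‖u.val e y‖ + ε) - Real.log (‖u.val e x‖ + ε)| ≤ b * M ^ 2 * (y - x) := by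
      intro x y hxy hx hy
      refine abs_comp_norm_val_sub_le_mul hae (α := 0) (β := M) (W := fun s => Real.log (s + ε))
        (W' := fun s => (s + ε)⁻¹) (w := fun s => (s + ε)⁻¹) hxy hx hy
        (fun t ht => ⟨norm_nonneg _, hM t (Icc_subset_interval hx hy ht)⟩) (fun s hs => ?_)
        (fun s hs => ?_) ?_ fun s hs => ?_
      · have : s + ε ≠ 0 := by linarith [hs.1]
        simpa using ((hasDerivAt_id s).add_const ε).log this
      · rw [abs_of_nonneg (inv_nonneg.2 (by linarith [hs.1]))]
      · exact ContinuousOn.inv₀ (by fun_prop) fun s hs => by linarith [hs.1]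
      · have hsε : 0 < s + ε := by linarith [hs.1]
        rw [← div_eq_mul_inv, div_le_iff₀ hsε]
        have h1 := solitonWeight_le hb M hs.1
        have h2 : 0 ≤ b * M ^ 2 * ε := by positivity
        linarith
    rcases le_total x y with h | h
    · have := (abs_le.1 (haux h hx hy)).2
      rw [h0, norm_zero, zero_add] at this
      rwa [abs_of_nonneg (sub_nonneg.2 h)]
    · have := (abs_le.1 (haux h hy hx)).1
      rw [h0, norm_zero, zero_add] at this
      rw [abs_of_nonpos (sub_nonpos.2 h)]
      linarith
  have hle : ∀ ε > 0, ‖u.val e y‖ ≤ ε * Real.exp (b * M ^ 2 * |y - x|) := by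
    intro ε hε
    have h1 : Real.log (‖u.val e y‖ + ε) ≤ Real.log ε + b * M ^ 2 * |y - x| := by linarith [key ε hε]
    have h2 := Real.exp_le_exp.2 h1
    rw [Real.exp_log (by positivity), Real.exp_add, Real.exp_log hε] at h2
    linarith
  have hlim : Tendsto (fun ε : ℝ => ε * Real.exp (b * M ^ 2 * |y - x|)) (𝓝[>] 0)
      (𝓝 (0 * Real.exp (b * M ^ 2 * |y - x|))) :=
    (tendsto_id.mul_const _).mono_left nhdsWithin_le_nhds
  rw [zero_mul] at hlim
  exact norm_le_zero_iff.1 (ge_of_tendsto hlim (eventually_mem_nhdsWithin.mono hle))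

theorem abs_solitonPosition_sub_le {e : E}
    (hae : ∀ᵐ t ∂volume.restrict (G.interval e), ‖u.der e t‖ = solitonWeight b M ‖u.val e t‖)
    (hb : 0 < b) (hM0 : 0 < M) (hM : ∀ x ∈ G.interval e, ‖u.val e x‖ ≤ M)
    (hne : ∀ x ∈ G.interval e, u.val e x ≠ 0) {x y : ℝ} (hx : x ∈ G.interval e)
    (hy : y ∈ G.interval e) :
    |solitonPosition (2 * b * M ^ 2) M ‖u.val e x‖ -
      solitonPosition (2 * b * M ^ 2) M ‖u.val e y‖| ≤ |x - y| := by
  wlog hxy : x ≤ y generalizing x y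
  · rw [abs_sub_comm, abs_sub_comm x y]
    exact this hy hx (le_of_not_ge hxy)
  rw [abs_sub_comm, abs_sub_comm x y, abs_of_nonneg (sub_nonneg.2 hxy)]
  have hsub := Icc_subset_interval hx hy
  -- A positive lower bound for ‖u‖ on the segment keeps the weights continuous. The contraction
  -- estimate is proved for A > M² and passed to the limit.
  obtain ⟨z, hz, hmin⟩ := isCompact_Icc.exists_isMinOn (nonempty_Icc.2 hxy)
    ((u.continuousOn_val e).mono hsub).norm
  have hδ : 0 < ‖u.val e z‖ := norm_pos_iff.2 (hne z (hsub hz))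
  set k := 2 * b * M ^ 2 with hk
  have hk0 : 0 < k := by positivity
  have key : ∀ A, M ^ 2 < A → |Real.arcosh (A / ‖u.val e y‖ ^ 2) / k -
      Real.arcosh (A / ‖u.val e x‖ ^ 2) / k| ≤ y - x := by
    intro A hA
    have hA0 : 0 < A := lt_trans (by positivity) hA
    have hlt : ∀ s ∈ Icc ‖u.val e z‖ M, s ^ 2 < A := fun s hs =>
      (pow_le_pow_left₀ (hδ.le.trans hs.1) hs.2 2).trans_lt hA
    have hpos : ∀ s ∈ Icc ‖u.val e z‖ M, 0 < s := fun s hs => hδ.trans_le hs.1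
    have hroot : ∀ s ∈ Icc ‖u.val e z‖ M, 0 < √((A / s ^ 2) ^ 2 - 1) := fun s hs => by
      have := hpos s hs
      have h1 : 1 < A / s ^ 2 := (one_lt_div (by positivity)).2 (hlt s hs)
      exact Real.sqrt_pos.2 (by nlinarith)
    refine (abs_comp_norm_val_sub_le_mul hae (C := 1) (α := ‖u.val e z‖) (β := M)
      (W := fun s => Real.arcosh (A / s ^ 2) / k)
      (W' := fun s => -((√((A / s ^ 2) ^ 2 - 1))⁻¹ * (2 * A / s ^ 3) / k))
      (w := fun s => (√((A / s ^ 2) ^ 2 - 1))⁻¹ * (2 * A / s ^ 3) / k) hxy hx hy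
      (fun t ht => ⟨hmin ht, hM t (hsub ht)⟩)
      (fun s hs => hasDerivAt_arcosh_div_sq (hpos s hs) (hlt s hs)) (fun s hs => ?_) ?_
      fun s hs => solitonWeight_mul_le hb hM0 (hpos s hs) hs.2 hA).trans_eq (one_mul _)
    · have h1 := hpos s hs
      have h2 := hroot s hs
      rw [abs_neg, abs_of_nonneg (by positivity)]
    · have h1 : ContinuousOn (fun s : ℝ => A / s ^ 2) (Icc ‖u.val e z‖ M) :=
        continuousOn_const.div (by fun_prop) fun s hs => pow_ne_zero 2 (hpos s hs).ne'
      have h2 : ContinuousOn (fun s : ℝ => 2 * A / s ^ 3) (Icc ‖u.val e z‖ M) :=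
        continuousOn_const.div (by fun_prop) fun s hs => pow_ne_zero 3 (hpos s hs).ne'
      exact ((((h1.pow 2).sub continuousOn_const).sqrt.inv₀ fun s hs => (hroot s hs).ne').mul
        h2).div_const k
  have hlim : ∀ t ∈ Icc x y, Tendsto (fun A => Real.arcosh (A / ‖u.val e t‖ ^ 2) / k)
      (𝓝[>] (M ^ 2)) (𝓝 (solitonPosition k M ‖u.val e t‖)) := by
    intro t ht
    have htp : 0 < ‖u.val e t‖ := norm_pos_iff.2 (hne t (hsub ht))
    have hle := pow_le_pow_left₀ htp.le (hM t (hsub ht)) 2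
    have h1 : (1 : ℝ) ≤ M ^ 2 / ‖u.val e t‖ ^ 2 := (one_le_div (by positivity)).2 hle
    refine Tendsto.div_const ((Real.continuousOn_arcosh _ h1).tendsto.comp
      (tendsto_nhdsWithin_iff.2 ⟨(tendsto_id.div_const _).mono_left nhdsWithin_le_nhds, ?_⟩)) k
    filter_upwards [self_mem_nhdsWithin] with A hA
    exact (one_le_div (by positivity)).2 (hle.trans (mem_Ioi.1 hA).le)
  exact le_of_tendsto ((hlim y (right_mem_Icc.2 hxy)).sub (hlim x (left_mem_Icc.2 hxy))).abs
    (eventually_mem_nhdsWithin.mono key)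

variable [Fintype E]

/-- A function of critical mass and zero energy satisfies the soliton equation. -/
theorem norm_der_eq_solitonWeight (hconn : G.Connected) (hm : u.mass = √3 * Real.pi / 4)
    (hE : u.energy = 0) {e₀ : E} {x₀ : ℝ} (hx₀ : x₀ ∈ G.interval e₀)
    (hmax : ∀ e, ∀ x ∈ G.interval e, ‖u.val e x‖ ≤ ‖u.val e₀ x₀‖) (e : E) :
    ∀ᵐ t ∂volume.restrict (G.interval e),
      ‖u.der e t‖ = solitonWeight (√3)⁻¹ ‖u.val e₀ x₀‖ ‖u.val e t‖ := by
  set M := ‖u.val e₀ x₀‖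
  have h3 : (√3)⁻¹ ^ 2 = (1 / 3 : ℝ) := by rw [inv_pow, Real.sq_sqrt (by norm_num)]; norm_num
  have hs3 : (0 : ℝ) < √3 := Real.sqrt_pos.2 (by norm_num)
  have hb : (0 : ℝ) ≤ (√3)⁻¹ := by positivity
  -- Here b = 1/√3 is π/(4 mass) at the critical mass. Zero energy means kinetic = potential/3, and
  -- the integral of the square is squeezed to 0.
  have h1 := u.integral_sq_sub_solitonWeight hb hmax
  have h2 := u.le_integral_norm_der_mul_solitonWeight hconn hb hx₀
  have h4 : (√3)⁻¹ = √3 / 3 := by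
    have := Real.sq_sqrt (show (0 : ℝ) ≤ 3 by norm_num)
    field_simp; linarith
  rw [h3, hm] at h1
  rw [energy] at hE
  have h5 : (√3)⁻¹ * Real.pi * M ^ 4 / 8 = M ^ 4 * (√3 * Real.pi / 4) / 6 := by rw [h4]; ring
  rw [h5] at h2
  have h6 : G.integral (fun e x => (‖u.der e x‖ - solitonWeight (√3)⁻¹ M ‖u.val e x‖) ^ 2) ≤ 0 := by
    rw [h1]; linarith
  have hnn : ∀ e ∈ Finset.univ, 0 ≤ ∫ x in G.interval e,
      (‖u.der e x‖ - solitonWeight (√3)⁻¹ M ‖u.val e x‖) ^ 2 :=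
    fun e _ => integral_nonneg fun x => sq_nonneg _
  have h7 := (Finset.sum_eq_zero_iff_of_nonneg hnn).1
    (le_antisymm h6 (Finset.sum_nonneg hnn)) e (Finset.mem_univ e)
  rw [integral_eq_zero_iff_of_nonneg (fun x => sq_nonneg _)
    (u.integrableOn_sq_sub_solitonWeight hb hmax e)] at h7
  filter_upwards [h7] with x hx
  exact sub_eq_zero.1 (pow_eq_zero_iff two_ne_zero |>.1 hx)

end H1

variable [Fintype E]

theorem HasGroundState.isHalfline (hconn : G.Connected)
    (h : G.HasGroundState (√3 * Real.pi / 4)) : G.IsHalfline := by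
  have hpi := Real.pi_pos
  have hs3 : (0 : ℝ) < √3 := Real.sqrt_pos.2 (by norm_num)
  obtain ⟨u, hm, hE⟩ := h
  rw [groundEnergy_eq_zero hconn] at hE
  replace hE : u.energy = 0 := by exact_mod_cast hE
  obtain ⟨e₀, x₀, hx₀, hmax⟩ := u.exists_max_norm_val
  have hae := H1.norm_der_eq_solitonWeight hconn hm hE hx₀ hmax
  set M := ‖u.val e₀ x₀‖ with hMdef
  have hM0 : 0 < M := by
    refine lt_of_le_of_ne (norm_nonneg _) fun h0 => ?_
    have : u.mass = 0 := Finset.sum_eq_zero fun e _ =>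
      setIntegral_eq_zero_of_forall_eq_zero fun x hx => by
        have := hmax e x hx
        rw [← h0] at this
        simpa using norm_le_zero_iff.1 this
    rw [this] at hm
    have : 0 < √3 * Real.pi / 4 := by positivity
    linarith
  have hb : (0 : ℝ) < (√3)⁻¹ := inv_pos.2 hs3
  have hne : ∀ e, ∀ x ∈ G.interval e, u.val e x ≠ 0 := by
    have hedge : ∀ e, ∀ x ∈ G.interval e, u.val e x ≠ 0 → ∀ y ∈ G.interval e, u.val e y ≠ 0 :=
      fun e x hx hxne y hy hy0 =>
        hxne (H1.val_eq_zero_of_val_eq_zero (hae e) hb.le (hmax e) hy hx hy0)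
    exact hconn.forall_edge (A := fun e => ∀ x ∈ G.interval e, u.val e x ≠ 0)
      (fun v e x e' x' h h' hA => hedge e' x' h'.mem_interval
        (u.continuous_vertex v e x e' x' h h' ▸ hA x h.mem_interval))
      (hedge e₀ x₀ hx₀ (norm_pos_iff.1 hM0))
  -- For k = 2bM² the profile M φ(ky) satisfies the soliton equation with weight parameters b and M.
  set k := 2 * (√3)⁻¹ * M ^ 2 with hk
  have hk0 : 0 < k := by positivity
  have hpos : ∀ e, ∀ x ∈ G.interval e, 0 < ‖u.val e x‖ := fun e x hx => norm_pos_iff.2 (hne e x hx)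
  have hlip := fun e x hx y hy =>
    H1.abs_solitonPosition_sub_le (hae e) hb hM0 (hmax e) (hne e) (x := x) (y := y) hx hy
  have hsurj : ∀ y, 0 ≤ y ↔ ∃ e, ∃ x ∈ G.interval e, solitonPosition k M ‖u.val e x‖ = y := by
    refine fun y => ⟨fun hy => ?_, ?_⟩
    · have hs := soliton_pos (k * y)
      obtain ⟨e, x, hx, hux⟩ := u.exists_norm_val_eq hconn (mul_pos hM0 hs) hx₀
        (mul_le_of_le_one_right hM0.le (soliton_le_one _))
      exact ⟨e, x, hx, by rw [hux, solitonPosition_mul_soliton hk0 hM0 hy]⟩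
    · rintro ⟨e, x, hx, rfl⟩
      exact solitonPosition_nonneg hk0 (hpos e x hx) (hmax e x hx)
  have hsq : ∀ e, ∀ x ∈ G.interval e,
      ‖u.val e x‖ ^ 2 = M ^ 2 * soliton (k * solitonPosition k M ‖u.val e x‖) ^ 2 :=
    fun e x hx => (sq_mul_soliton_solitonPosition hk0 (hpos e x hx) (hmax e x hx)).symm
  have hFi : IntegrableOn (fun y => M ^ 2 * soliton (k * y) ^ 2) (Ioi 0) := by
    refine Integrable.const_mul ?_ _
    have := (integrableOn_Ioi_comp_mul_left_iff (fun y => soliton y ^ 2) 0 hk0).2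
    rw [mul_zero] at this
    exact this integrableOn_soliton_sq
  -- The mass M² π/(2k) = π/(4b) does not depend on M and equals the critical mass.
  have hFv : ∫ y in Ioi 0, M ^ 2 * soliton (k * y) ^ 2 = √3 * Real.pi / 4 := by
    have := integral_comp_mul_left_Ioi (fun y => soliton y ^ 2) 0 hk0
    rw [mul_zero, integral_soliton_sq] at this
    rw [integral_const_mul, this, hk, smul_eq_mul]
    field_simp; norm_num
  -- The positive test function is the squared soliton profile, whose composition with the position
  -- map is ‖u‖²; equal masses are the required equality of integrals.
  have hmeas := fun A hA => sum_volume_preimage_eq (A := A) hlip hsurj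
    (F := fun y => M ^ 2 * soliton (k * y) ^ 2)
    (by have := continuous_soliton; fun_prop)
    (fun y => by have := soliton_pos (k * y); positivity) hFi
    (fun e => (u.integrableOn_norm_val_sq e).congr_fun (hsq e) (measurableSet_interval e))
    (by
      rw [hFv, ← hm]
      exact Finset.sum_congr rfl fun e _ =>
        (setIntegral_congr_fun (measurableSet_interval e) (hsq e)).symm) hA
  exact isHalfline_of_sum_volume_preimage_eq hlip hmeas hconn hsurj fun v e x e' x' h h' => by
    rw [u.continuous_vertex v e x e' x' h h']

end MetricGraph

theorem theorem7p1 {V E : Type*} [Finite V] [Fintype E] (G : MetricGraph V E)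
    (hconn : G.Connected) (hterm : ∃ v, G.IsTerminal v) :
    (0 < MetricGraph.halfline.criticalMass ∧
      MetricGraph.halfline.criticalMass < MetricGraph.line.criticalMass) ∧
    G.criticalMass = MetricGraph.halfline.criticalMass ∧
    (∀ μ : ℝ, μ ∈ Set.Ioc MetricGraph.halfline.criticalMass MetricGraph.line.criticalMass →
      G.groundEnergy μ = ⊥) ∧
    G.groundEnergy MetricGraph.halfline.criticalMass = 0 ∧
    (G.HasGroundState MetricGraph.halfline.criticalMass ↔ G.IsHalfline) := by
  have hpi := Real.pi_pos
  have hhalf := MetricGraph.criticalMass_eq MetricGraph.halfline_connected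
    ⟨none, MetricGraph.halfline_isTerminal⟩
  rw [hhalf]
  exact ⟨⟨by positivity, MetricGraph.lt_line_criticalMass⟩, MetricGraph.criticalMass_eq hconn hterm,
    fun μ hμ => MetricGraph.groundEnergy_eq_bot hterm hμ.1, MetricGraph.groundEnergy_eq_zero hconn,
    fun h => h.isHalfline hconn, fun h => h.hasGroundState hconn⟩
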